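/- Let $G$ be a finite group with an abelian normal $2$-subgroup $A$ such that $[G:A]=6$, and assume that $A$ has a complement $H$ in $G$. Let $P$ be the Sylow $3$-subgroup of $H$, let $y$ be an involution of $H$ and let $Q=A\langle y\rangle$ (a Sylow $2$-subgroup of $G$). Assume that $Q$ is nonabelian, that $\mathbf{C}_A(P)=1$, that $H\cong C_6$, and that the nilpotency class of $Q$ is greater than $2$. Let $\mathrm{N}(G)$ denote the set of nonvanishing elements of $G$, that is, of those $g\in G$ with $\chi(g)\neq 0$ for every irreducible complex character $\chi$ of $G$. Write $a^g=g^{-1}ag$, $a^{kg}=(a^k)^g$, $[a,g]=a^{-1}a^g$, $[E,y]=\langle [e,y] : e\in E\rangle$, $[C,y,y]=[[C,y],y]$, let $\langle a\rangle^G$ be the normal closure of $a$ in $G$, $\exp$ the exponent, and let the rank of a finite abelian $2$-group be its minimal number of generators (the number of factors in a decomposition into nontrivial cyclic groups). Then $A\subseteq \mathrm{N}(G)$ if and only if $A=B\times C$ with $B,C$ normal in $G$ such that $\exp([C,y])\le 2$, $[C,y,y]=1$, and there are an integer $k>0$ and an element $b_0\in B$ such that, putting $B_0=\langle b_0\rangle^G$,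 the group $B$ is a direct product of $k$ normal subgroups of $G$, each isomorphic to $B_0$ as an $H$-module (with $H$ acting by conjugation), $\exp(B)>\exp(C)$, $\operatorname{rank}(B_0)\ge\operatorname{rank}(\langle c\rangle^G)$ for all $c\in C$, and one of the following holds: (1) for a suitable generator $x$ of $P$, $B_0=\langle b_0,b_0^x\rangle\cong (C_8)^2$ and $b_0b_0^y=b_0^{4x}$; moreover $\operatorname{rank}(\langle c\rangle^G)=2$ for every $c\in C$ with $c\neq 1$, and $c^y=c^{-1}$ for every $c\in C$; (2) for a suitable generator $x$ of $P$ and some integer $n\ge 3$, $B_0=ED$, where $E=\langle b_0,b_0^x\rangle\cong (C_{2^n})^2$ and $D=[E,y]\cong (C_4)^2$, and $b_0^{2^{n-1}}=[b_0^2,y]^x$. -/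

import Mathlib

/-- `Irr(G)`: the characters of the irreducible finite-dimensional complex representations of `G`. -/
def irrCharacters (G : Type*) [Group G] : Set (G → ℂ) :=
  {χ | ∃ (n : ℕ) (ρ : Representation ℂ G (Fin n → ℂ)), ρ.IsIrreducible ∧ χ = ρ.character}

/-- The set of vanishing elements: zeros of some irreducible complex character. -/
def vanishingSet (G : Type*) [Group G] : Set G :=
  {g | ∃ χ ∈ irrCharacters G, χ g = 0}

/-- The set of nonvanishing elements, the complement of the set of vanishing elements. -/
def nonvanishingSet (G : Type*) [Group G] : Set G :=
  (vanishingSet G)ᶜ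

/-- The conjugate `a ^ g = g⁻¹ a g`. -/
def conjBy {G : Type*} [Group G] (a g : G) : G :=
  g⁻¹ * a * g

/-- The commutator `[a, y] = a⁻¹ a ^ y = a⁻¹ y⁻¹ a y`. -/
def commBy {G : Type*} [Group G] (a y : G) : G :=
  a⁻¹ * conjBy a y

/-- `[E, y]`: the subgroup generated by all commutators `[e, y]` with `e ∈ E`. -/
def commSubgroup {G : Type*} [Group G] (E : Subgroup G) (y : G) : Subgroup G :=
  Subgroup.closure {g | ∃ e ∈ E, g = commBy e y}

/-- `V` and `W` are isomorphic as `H`-modules, where `H` acts on both of them by conjugation. -/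
def ModuleIso {G : Type*} [Group G] (H V W : Subgroup G) : Prop :=
  ∃ φ : V ≃* W, ∀ h ∈ H, ∀ v v' : V,
    (v' : G) = conjBy (v : G) h → (φ v' : G) = conjBy (φ v : G) h

/-- `B` is the (internal) direct product of `k` normal subgroups of `G`, each of which is
isomorphic to `B₀` as an `H`-module. It is applied to subgroups of an abelian normal subgroup. -/
def IsDirectProductOfCopies {G : Type*} [Group G] (H B B₀ : Subgroup G) (k : ℕ) : Prop :=
  ∃ f : Fin k → Subgroup G,
    (∀ i, (f i).Normal) ∧ (∀ i, ModuleIso H (f i) B₀) ∧ iSupIndep f ∧ ⨆ i, f i = B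

/-- The group `C_m × C_m`. -/
abbrev CyclicSq (m : ℕ) : Type :=
  Multiplicative (ZMod m) × Multiplicative (ZMod m)

/-!
# Nonvanishing elements of an abelian normal `2`-subgroup of index `6` with a cyclic complement

Write `A` additively, let `x` generate `P`, and let `S` be the commutative ring of endomorphisms of
`A` generated by the conjugations `x` and `y`. Since `x` has no nontrivial fixed points,
`x² + x + 1 = 0`, and `y² = 1`; moreover `2` is nilpotent, so that a combination of `1` and `x` with integral
coefficients that are not both even is a unit (`EisensteinInvolution`, `IsConjAction`).

*Characters.* For `a ∈ A`, the sum over the orbit of `a` under `⟨x, y⟩` is central in the group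
algebra, so it acts on an irreducible module as a scalar, which is the value of a linear character
of `A` on this sum. Every linear character of `A` occurs, whence `A ⊆ N(G)` if and only if no
linear character has a vanishing sum over an orbit (`IsConjAction.subset_nonvanishingSet_iff`). In
a vanishing sum of roots of unity of `2`-power order, each term is cancelled by its negative
(`exists_eq_neg_of_sum_eq_zero`). The product of the values at `a`, `x a` and `x² a` being `1`, a
vanishing sum needs a match within an orbit of `x`, and then the character takes the value `-1` at
three explicit elements. Such a character exists unless these elements satisfy an integral relation
with odd coefficient sum; this is `OddRelation` (`EisensteinInvolution.exists_orbitSum_eq_zero`,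
`EisensteinInvolution.orbitSum_ne_zero`).

*The ring.* Since `A⟨y⟩` has class greater than `2`, the endomorphism `2 (y - 1)` is not zero. If
all `a ∈ A` satisfy the odd relation for `y`, then `EisensteinInvolution.classification` shows,
after replacing `x` by `x²` if necessary, that either `8 = 0` and `y + 1 = 4 x`, or
`2 ^ (n - 1) = 2 x (y - 1)` for some `n ≥ 3`. Conversely either of these equations implies all odd relations. They
are the equations `b₀ b₀^y = b₀^{4x}` and `b₀^{2^{n-1}} = [b₀², y]^x` of the two cases.

*The module.* In both cases `σ = 2 ^ (n - 1)`, with `n = 3` in the first one, lies in each nonzero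
ideal of `S`. A finite module over such a ring is the direct sum of a free module and a module
killed by `σ` (`exists_free_sup_torsion`); these summands are `B` and `C`, and the properties of
the normal closures can be read off from the action of `S`. In the other direction, the stated
properties of `B` and `C` imply that the relevant equation holds on `B` and on `C`, hence in `S`.
-/

/-! ### The ring generated by a cube root of unity and an involution -/

/-- The properties of the ring generated by the actions of `x` and `y` on an abelian normal
`2`-subgroup on which `x` acts fixed-point-freely: a commutative ring in which `2` is nilpotent,
generated by an element `x` with `x² + x + 1 = 0` and an element `y` with `y² = 1`. -/
structure EisensteinInvolution {S : Type*} [CommRing S] (x y : S) : Prop where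
  sq_add : x ^ 2 + x + 1 = 0
  sq_eq : y ^ 2 = 1
  nil : ∃ N : ℕ, (2 : S) ^ N = 0
  gen : ∀ s : S, ∃ i j k l : ℤ, s = i + j * x + (k + l * x) * y

/-- The relation that prevents a vanishing orbit sum at `a` in which the conjugates of `a` by
`x` are matched with the conjugates by `z`, where `z` is one of `y`, `x y`, `x² y`:
such a matching amounts to a character with value `-1` at `(1 - x) a`, at `(1 - x) z a` and at
`2 (z - 1) a`, and an odd relation is, up to the unit `1 - x`, a vanishing integral combination of
these elements with odd coefficient sum. -/
def OddRelation {S M : Type*} [CommRing S] [AddCommGroup M] [Module S M] (x z : S) (a : M) :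
    Prop :=
  ∃ p q r : ℤ, Odd (p + q + r) ∧ ((p : S) + q * z + 2 * r * x * (z - 1)) • a = 0

namespace EisensteinInvolution

variable {S M : Type*} [CommRing S] [AddCommGroup M] [Module S M] {x y : S}

lemma cube (h : EisensteinInvolution x y) : x ^ 3 = 1 := by
  linear_combination (x - 1) * h.sq_add

/-- The square of `x` is the other primitive cube root of unity. -/
lemma symm (h : EisensteinInvolution x y) : EisensteinInvolution (x ^ 2) y where
  sq_add := by linear_combination (x ^ 2 - x + 1) * h.sq_add
  sq_eq := h.sq_eq
  nil := h.nil
  gen s := by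
    obtain ⟨i, j, k, l, rfl⟩ := h.gen s
    refine ⟨i - j, -j, k - l, -l, ?_⟩
    push_cast
    linear_combination (j + l * y) * h.sq_add

lemma isUnit_intCast (h : EisensteinInvolution x y) {n : ℤ} (hn : Odd n) : IsUnit (n : S) := by
  obtain ⟨m, rfl⟩ := hn
  obtain ⟨N, hN⟩ := h.nil
  have : IsNilpotent ((2 : S) * m) := ⟨N, by rw [mul_pow, hN, zero_mul]⟩
  have := this.isUnit_one_add
  push_cast
  rwa [add_comm] at this

lemma isUnit_one_sub (h : EisensteinInvolution x y) : IsUnit (1 - x) :=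
  isUnit_of_mul_isUnit_left (y := 1 - x ^ 2) (by
    have h3 := h.isUnit_intCast (n := 3) (by decide)
    convert h3 using 1
    push_cast
    linear_combination (x - 2) * h.sq_add)

/-- The norm `i² - i j + j²` of the Eisenstein integer `i + j x` is odd unless both `i` and `j`
are even. -/
lemma isUnit_add_mul (h : EisensteinInvolution x y) {i j : ℤ} (hij : Odd i ∨ Odd j) :
    IsUnit ((i : S) + j * x) := by
  refine isUnit_of_mul_isUnit_left (y := (i : S) + j * x ^ 2) ?_
  have hodd : Odd (i ^ 2 - i * j + j ^ 2) := by
    rcases Int.even_or_odd i with hi | hi <;> rcases Int.even_or_odd j with hj | hj <;>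
      simp_all [parity_simps, ← Int.not_even_iff_odd]
  convert h.isUnit_intCast hodd using 1
  push_cast
  linear_combination (i * j + j ^ 2 * (x - 1) : S) * h.sq_add

lemma isUnit_add_mul_add (h : EisensteinInvolution x y) {i j k l : ℤ}
    (hij : Odd (i + k) ∨ Odd (j + l)) : IsUnit ((i : S) + j * x + (k + l * x) * y) := by
  refine isUnit_of_mul_isUnit_left (y := (i : S) + j * x - (k + l * x) * y) ?_
  have h1 := h.isUnit_add_mul hij
  have h2 := h.isUnit_add_mul (i := i - k) (j := j - l) (by
    simpa [parity_simps] using hij)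
  convert h1.mul h2 using 1
  push_cast
  linear_combination (-(k + l * x) ^ 2 : S) * h.sq_eq

lemma sub_one_sq (h : EisensteinInvolution x y) : (y - 1) * (y - 1) = -2 * (y - 1) := by
  linear_combination h.sq_eq

end EisensteinInvolution

lemma intCast_mul_of_odd {S : Type*} [CommRing S] {n : ℤ} (hn : Odd n) {m : S}
    (hm : 2 * m = 0) : (n : S) * m = m := by
  obtain ⟨k, rfl⟩ := hn
  push_cast
  linear_combination (k : S) * hm

lemma intCast_mul_of_even {S : Type*} [CommRing S] {n : ℤ} (hn : Even n) {m : S}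
    (hm : 2 * m = 0) : (n : S) * m = 0 := by
  obtain ⟨k, rfl⟩ := hn
  push_cast
  linear_combination (k : S) * hm

/-! ### Consequences of an odd relation in the ring -/

namespace EisensteinInvolution

section Ring

variable {S : Type*} [CommRing S] {x y : S}

/-- If `4 P` is nonzero and killed by `2`, then the characteristic is `2 ^ n` with `n ≥ 3`, and
`4 P = 2 ^ (n - 1)`. -/
lemma exists_two_pow_of_four_mul (h : EisensteinInvolution x y) {P : ℤ}
    (h0 : (4 * P : S) ≠ 0) (h2 : (8 * P : S) = 0) :
    ∃ n, 3 ≤ n ∧ (2 : S) ^ (n - 1) ≠ 0 ∧ (2 : S) ^ n = 0 ∧ (4 * P : S) = 2 ^ (n - 1) ∧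
      (Odd P → n = 3) := by
  have hP : P ≠ 0 := by rintro rfl; simp at h0
  obtain ⟨j, u, hu, rfl⟩ : ∃ (j : ℕ) (u : ℤ), Odd u ∧ P = 2 ^ j * u := by
    obtain ⟨u, hPu, hu⟩ := (Int.finiteMultiplicity_iff.2 ⟨by decide, hP⟩ :
      FiniteMultiplicity (2 : ℤ) P).exists_eq_pow_mul_and_not_dvd
    exact ⟨_, u, by rwa [← Int.not_even_iff_odd, even_iff_two_dvd], hPu⟩
  push_cast at h0 h2
  have hk : (2 : S) ^ (j + 3) = 0 := by
    rw [← (h.isUnit_intCast hu).mul_left_eq_zero]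
    linear_combination h2
  have e : (4 * (2 ^ j * u) : S) = 2 ^ (j + 2) := by
    have := intCast_mul_of_odd hu (m := (2 : S) ^ (j + 2)) (by linear_combination hk)
    linear_combination this
  refine ⟨j + 3, by omega, ?_, hk, by push_cast; exact e, fun ho ↦ ?_⟩
  · rwa [e] at h0
  · rcases j with _ | j
    · rfl
    · exact absurd ho (Int.not_odd_iff_even.2 ⟨2 ^ j * u, by ring⟩)

/-- An odd relation for `y` forces `2 (y - 1)` to be a root of unity times the largest nonzero
power of `2`. The relation reads `(q + 2 r x) (y - 1) = -(p + q)`, which is solved for `y - 1`,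
up to an odd factor, by means of the conjugate of the Eisenstein integer `q + 2 r x` (or of
`q / 2 + r x` if `q` is even); comparison with `(y - 1)² = -2 (y - 1)` then shows that
`4 (y - 1) = 0`. -/
lemma two_mul_sub_one_of_relation (h : EisensteinInvolution x y) {p q r : ℤ}
    (hodd : Odd (p + q + r)) (hrel : (p : S) + q * y + 2 * r * x * (y - 1) = 0) :
    2 * (y - 1) = 0 ∨ ∃ n, 3 ≤ n ∧ (2 : S) ^ (n - 1) ≠ 0 ∧ (2 : S) ^ n = 0 ∧
      ((∃ ε ∈ ({x, x ^ 2} : Set S), 2 * (y - 1) = 2 ^ (n - 1) * ε) ∨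
       (n = 3 ∧ 2 * (y - 1) = 2 ^ (n - 1) ∧ ∃ ε ∈ ({x, x ^ 2} : Set S), y + 1 = 4 * ε)) := by
  have hδ := h.sub_one_sq
  have hx := h.sq_add
  by_cases hw : 2 * (y - 1) = 0
  · exact .inl hw
  right
  rcases Int.even_or_odd r with hre | hro
  · -- exactly one of `p` and `q` is odd, so that the relation is a unit
    have hu := h.isUnit_add_mul_add (i := p) (j := -(2 * r)) (k := q) (l := 2 * r) (.inl (by
      simpa [parity_simps, hre, ← Int.not_even_iff_odd] using hodd))
    have hu0 : IsUnit (0 : S) := by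
      convert hu using 1; push_cast; linear_combination -hrel
    exact absurd (by rw [← hu0.mul_right_eq_zero, zero_mul]) hw
  rcases Int.even_or_odd p with hp | hp
  · have hq : Even q := by grind
    obtain ⟨p, rfl⟩ := hp
    obtain ⟨q, rfl⟩ := hq
    push_cast at hrel
    rcases Int.even_or_odd (p + q) with hP | hP
    swap
    · have hu := h.isUnit_add_mul_add (i := p) (j := -r) (k := q) (l := r) (.inl hP)
      have : (2 : S) = 0 := by
        rw [← hu.mul_right_eq_zero]
        push_cast
        linear_combination hrel
      exact absurd (by linear_combination (y - 1) * this) hw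
    obtain ⟨P, hP⟩ := hP
    have hP' : (p : S) + q = P + P := by exact_mod_cast congrArg (Int.cast : ℤ → S) hP
    -- `q + r x` has norm `N` and conjugate `c`
    obtain ⟨N, hN⟩ : ∃ N : ℤ, N = q ^ 2 - q * r + r ^ 2 := ⟨_, rfl⟩
    have hNodd : Odd N := by
      rw [hN]
      rcases Int.even_or_odd q with hi | hi <;>
        simp_all [parity_simps, ← Int.not_even_iff_odd]
    have hN' : (N : S) = q ^ 2 - q * r + r ^ 2 := by exact_mod_cast congrArg (Int.cast : ℤ → S) hN
    obtain ⟨c, hc⟩ : ∃ c : S, c = q - r - r * x := ⟨_, rfl⟩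
    have hcu : IsUnit c := by
      convert h.isUnit_add_mul (i := q - r) (j := -r) (.inr hro.neg) using 1
      rw [hc]; push_cast; ring
    have h1 : 2 * N * (y - 1) = -(4 * P * c) := by
      rw [hN', hc]
      linear_combination (q - r - r * x : S) * hrel - 2 * (q - r - r * x : S) * hP' +
        2 * r ^ 2 * (y - 1) * hx
    have h2 : 2 * (N - P * c) * (2 * (y - 1)) = 0 := by
      linear_combination 2 * N * hδ - (y - 1) * h1
    have hu : IsUnit ((N : S) - P * c) := by
      convert h.isUnit_add_mul (i := N - P * (q - r)) (j := P * r)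
        ((Int.even_or_odd P).imp (fun hPe ↦ hNodd.sub_even (hPe.mul_right _))
          fun hPo ↦ hPo.mul hro) using 1
      rw [hc]; push_cast; ring
    have h3 : 2 * (2 * (y - 1)) = 0 := by
      rw [← hu.mul_right_eq_zero]
      linear_combination h2
    have h4 := intCast_mul_of_odd hNodd h3
    have h5 : 2 * (y - 1) = -(4 * P * c) := by linear_combination h1 - h4
    obtain ⟨n, hn, hn1, hn2, hPn, -⟩ := h.exists_two_pow_of_four_mul (P := P)
      (fun h0 ↦ hw (by rw [h5, h0, zero_mul, neg_zero])) (by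
        rw [← hcu.mul_left_eq_zero]
        linear_combination 2 * h5 - h3)
    have hn3 : (2 : S) * 2 ^ (n - 1) = 0 := by rw [mul_pow_sub_one (by omega), hn2]
    have hr := intCast_mul_of_odd hro hn3
    rw [hPn, hc] at h5
    refine ⟨n, hn, hn1, hn2, .inl ?_⟩
    rcases Int.even_or_odd q with hq | hq
    · have hq := intCast_mul_of_even hq hn3
      refine ⟨x ^ 2, by simp, ?_⟩
      linear_combination h5 - hq + (1 + x) * hr - 2 ^ (n - 1) * hx + (1 + x) * hn3
    · have hq := intCast_mul_of_odd hq hn3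
      refine ⟨x, by simp, ?_⟩
      linear_combination h5 - hq + (1 + x) * hr
  · have hq : Odd q := by grind
    obtain ⟨P, hP⟩ : Even (p + q) := by grind
    have hP' : (p : S) + q = P + P := by exact_mod_cast congrArg (Int.cast : ℤ → S) hP
    -- `q + 2 r x` has norm `N` and conjugate `c`
    obtain ⟨N, hN⟩ : ∃ N : ℤ, N = q ^ 2 - 2 * q * r + 4 * r ^ 2 := ⟨_, rfl⟩
    have hNodd : Odd N := hN ▸ (hq.pow.sub_even ⟨q * r, by ring⟩).add_even ⟨2 * r ^ 2, by ring⟩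
    have hN' : (N : S) = q ^ 2 - 2 * q * r + 4 * r ^ 2 := by
      exact_mod_cast congrArg (Int.cast : ℤ → S) hN
    obtain ⟨c, hc⟩ : ∃ c : S, c = q - 2 * r - 2 * r * x := ⟨_, rfl⟩
    have hcu : IsUnit c := by
      convert h.isUnit_add_mul (i := q - 2 * r) (j := -2 * r) (.inl (by grind)) using 1
      rw [hc]; push_cast; ring
    have h1 : N * (y - 1) = -(2 * P * c) := by
      rw [hN', hc]
      linear_combination (q - 2 * r - 2 * r * x : S) * hrel -
        (q - 2 * r - 2 * r * x : S) * hP' + 4 * r ^ 2 * (y - 1) * hx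
    have h2 : (N - P * c) * (2 * (y - 1)) = 0 := by
      linear_combination N * hδ - (y - 1) * h1
    have hPo : Odd P := by
      rw [← Int.not_even_iff_odd]
      intro hPe
      have hu : IsUnit ((N : S) - P * c) := by
        convert h.isUnit_add_mul (i := N - P * (q - 2 * r)) (j := P * (2 * r))
          (.inl (hNodd.sub_even (hPe.mul_right _))) using 1
        rw [hc]; push_cast; ring
      exact hw (by rwa [hu.mul_right_eq_zero] at h2)
    obtain ⟨g, hg⟩ : Even (N - P * (q - 2 * r)) :=
      hNodd.sub_odd (hPo.mul (hq.sub_even (even_two_mul r)))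
    have hg' : (N - P * (q - 2 * r) : S) = g + g := by
      exact_mod_cast congrArg (Int.cast : ℤ → S) hg
    have hPr : Odd (P * r) := hPo.mul hro
    have h3 : 2 * (2 * (y - 1)) = 0 := by
      have hu := h.isUnit_add_mul (i := g) (j := P * r) (.inr hPr)
      rw [← hu.mul_right_eq_zero]
      push_cast
      rw [hc] at h2
      linear_combination h2 - (2 * (y - 1)) * hg'
    have h4 := intCast_mul_of_odd hNodd h3
    have h5 : 2 * (y - 1) = -(4 * P * c) := by linear_combination 2 * h1 - h4
    obtain ⟨n, hn, hn1, hn2, hPn, hn3⟩ := h.exists_two_pow_of_four_mul (P := P)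
      (fun h0 ↦ hw (by rw [h5, h0, zero_mul, neg_zero])) (by
        rw [← hcu.mul_left_eq_zero]
        linear_combination 2 * h5 - h3)
    obtain rfl := hn3 hPo
    norm_num at hn1 hn2 hPn
    have hq8 := intCast_mul_of_odd hq (m := (4 : S)) (by linear_combination hn2)
    refine ⟨3, le_rfl, by norm_num; exact hn1, by norm_num; exact hn2, .inr ⟨rfl, ?_, ?_⟩⟩
    · rw [h5, hPn, hc]
      norm_num
      linear_combination -hq8 + (r + r * x - 1) * hn2
    · have h6 : N * (y + 1) = 4 * (g + P * r * x) := by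
        rw [hc] at h1
        linear_combination h1 + 2 * hg'
      have h7 : 2 * (y + 1) = 0 := by
        rw [← (h.isUnit_intCast hNodd).mul_right_eq_zero]
        linear_combination 2 * h6 + (g + P * r * x) * hn2
      rw [intCast_mul_of_odd hNodd h7] at h6
      have h8 : (4 : S) * 2 = 0 := by linear_combination hn2
      have hPr8 := intCast_mul_of_odd hPr (m := (4 : S)) (by linear_combination hn2)
      push_cast at hPr8
      rcases Int.even_or_odd g with hg | hg
      · have hg8 := intCast_mul_of_even hg (m := (4 : S)) (by linear_combination hn2)
        exact ⟨x, by simp, by linear_combination h6 + hg8 + x * hPr8⟩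
      · have hg8 := intCast_mul_of_odd hg (m := (4 : S)) (by linear_combination hn2)
        refine ⟨x ^ 2, by simp, ?_⟩
        linear_combination h6 + hg8 + x * hPr8 - 4 * hx + (1 + x) * hn2

end Ring

end EisensteinInvolution

/-! ### Consequences of odd relations in a module -/

namespace EisensteinInvolution

variable {S M : Type*} [CommRing S] [AddCommGroup M] [Module S M] {x y : S}

lemma quotient (h : EisensteinInvolution x y) (I : Ideal S) :
    EisensteinInvolution (Ideal.Quotient.mk I x) (Ideal.Quotient.mk I y) where
  sq_add := by simpa using congrArg (Ideal.Quotient.mk I) h.sq_add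
  sq_eq := by simpa using congrArg (Ideal.Quotient.mk I) h.sq_eq
  nil := h.nil.imp fun N hN ↦ by
    rw [← map_ofNat (Ideal.Quotient.mk I) 2, ← map_pow, hN, map_zero]
  gen s := by
    obtain ⟨s, rfl⟩ := Ideal.Quotient.mk_surjective s
    obtain ⟨i, j, k, l, rfl⟩ := h.gen s
    exact ⟨i, j, k, l, by simp⟩

/-- The consequences `two_mul_sub_one_of_relation` of an odd relation, for the quotient of the ring
by the annihilator of `a`. -/
lemma two_mul_sub_one_smul (h : EisensteinInvolution x y) {a : M} (hr : OddRelation x y a) :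
    (2 * (y - 1)) • a = 0 ∨
      ∃ n, 3 ≤ n ∧ (2 ^ (n - 1) : S) • a ≠ 0 ∧ (2 ^ n : S) • a = 0 ∧
      ((∃ ε ∈ ({x, x ^ 2} : Set S), (2 * (y - 1)) • a = (2 ^ (n - 1) * ε) • a) ∨
       (n = 3 ∧ (2 * (y - 1)) • a = (2 ^ (n - 1) : S) • a ∧
        ∃ ε ∈ ({x, x ^ 2} : Set S), (y + 1) • a = (4 * ε) • a)) := by
  obtain ⟨p, q, r, hodd, hrel⟩ := hr
  have key (s : S) : Ideal.Quotient.mk (Ideal.torsionOf S M a) s = 0 ↔ s • a = 0 := by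
    rw [Ideal.Quotient.eq_zero_iff_mem, Ideal.mem_torsionOf_iff]
  have key' (s t : S) : Ideal.Quotient.mk (Ideal.torsionOf S M a) s =
      Ideal.Quotient.mk (Ideal.torsionOf S M a) t ↔ s • a = t • a := by
    rw [← sub_eq_zero, ← map_sub, key, sub_smul, sub_eq_zero]
  have := (h.quotient (Ideal.torsionOf S M a)).two_mul_sub_one_of_relation hodd
    (by simpa only [map_add, map_mul, map_sub, map_intCast, map_one, map_ofNat]
      using (key _).2 hrel)
  simp only [Set.mem_insert_iff, Set.mem_singleton_iff, exists_eq_or_imp, exists_eq_left,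
    ← map_ofNat (Ideal.Quotient.mk (Ideal.torsionOf S M a)), ne_eq,
    ← map_one (Ideal.Quotient.mk (Ideal.torsionOf S M a)), ← map_sub, ← map_mul, ← map_pow,
    ← map_add, key, key'] at this ⊢
  exact this

/-- The elements `0, 1, x, x²` represent the residue field, so that they differ by units. -/
lemma eq_or_isUnit_sub (h : EisensteinInvolution x y) {ε ε' : S}
    (hε : ε ∈ ({0, 1, x, x ^ 2} : Set S)) (hε' : ε' ∈ ({0, 1, x, x ^ 2} : Set S)) :
    ε = ε' ∨ IsUnit (ε - ε') := by
  have key {ε : S} (hε : ε ∈ ({0, 1, x, x ^ 2} : Set S)) :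
      ∃ p ∈ ([(0, 0), (1, 0), (0, 1), (-1, -1)] : List (ℤ × ℤ)), ε = p.1 + p.2 * x := by
    rcases hε with rfl | rfl | rfl | rfl
    · exact ⟨(0, 0), by simp, by simp⟩
    · exact ⟨(1, 0), by simp, by simp⟩
    · exact ⟨(0, 1), by simp, by simp⟩
    · exact ⟨(-1, -1), by simp, by push_cast; linear_combination h.sq_add⟩
  obtain ⟨p, hp, rfl⟩ := key hε
  obtain ⟨q, hq, rfl⟩ := key hε'
  have hpq : ∀ p ∈ ([(0, 0), (1, 0), (0, 1), (-1, -1)] : List (ℤ × ℤ)),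
      ∀ q ∈ ([(0, 0), (1, 0), (0, 1), (-1, -1)] : List (ℤ × ℤ)),
      p = q ∨ (Odd (p.1 - q.1) ∨ Odd (p.2 - q.2)) := by decide
  rcases hpq p hp q hq with rfl | hodd
  · exact .inl rfl
  · right
    convert h.isUnit_add_mul hodd using 1
    push_cast
    ring

/-- A linear map that multiplies each vector by one of the scalars `σ ε`, with `ε` in the residue
field, and that kills the kernel of `σ`, is multiplication by one such scalar: every vector being
an eigenvector, there is only one eigenvalue. -/
lemma exists_uniform_scalar (h : EisensteinInvolution x y) {s σ : S} {E : Set S}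
    (hE : E ⊆ {0, 1, x, x ^ 2}) {a : M} (ha : σ • a ≠ 0)
    (hker : ∀ m : M, σ • m = 0 → s • m = 0)
    (heig : ∀ m : M, ∃ ε ∈ E, s • m = (σ * ε) • m) :
    ∃ ε ∈ E, ∀ m : M, s • m = (σ * ε) • m := by
  obtain ⟨ε, hε, hεa⟩ := heig a
  refine ⟨ε, hε, fun b ↦ ?_⟩
  obtain ⟨ε₁, hε₁, hε₁b⟩ := heig b
  obtain ⟨ε₂, hε₂, hε₂ab⟩ := heig (a + b)
  have hsum : ((ε - ε₂) * σ) • a = ((ε₂ - ε₁) * σ) • b := by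
    have : (σ * ε) • a + (σ * ε₁) • b = (σ * ε₂) • a + (σ * ε₂) • b := by
      rw [← hεa, ← hε₁b, ← smul_add, hε₂ab, smul_add]
    linear_combination (norm := module) this
  rcases h.eq_or_isUnit_sub (hE hε₂) (hE hε₁) with rfl | ⟨u, hu⟩
  · rcases h.eq_or_isUnit_sub (hE hε) (hE hε₂) with rfl | hu
    · exact hε₁b
    · rw [sub_self, zero_mul, zero_smul, mul_smul, hu.smul_eq_zero] at hsum
      exact absurd hsum ha
  · rw [← hu] at hsum
    -- `b` agrees, modulo the kernel of `σ`, with a multiple of `a`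
    have h0 := hker (b - (↑u⁻¹ * (ε - ε₂)) • a) (by
      rw [smul_sub, smul_smul, mul_left_comm, mul_comm σ, mul_smul _ _ a, hsum, smul_smul,
        ← mul_assoc, Units.inv_mul, one_mul, sub_self])
    have h1 : σ • b = (↑u⁻¹ * (ε - ε₂) * σ) • a := by
      rw [mul_assoc, mul_smul, hsum, smul_smul, ← mul_assoc, Units.inv_mul, one_mul]
    rw [smul_sub, sub_eq_zero, smul_comm, hεa] at h0
    rw [h0, mul_comm σ ε, mul_smul ε σ b, h1]
    module

lemma two_pow_smul_of_le {k l : ℕ} (hkl : k ≤ l) {m : M} (hm : (2 ^ k : S) • m = 0) :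
    (2 ^ l : S) • m = 0 := by
  obtain ⟨d, rfl⟩ := Nat.exists_eq_add_of_le hkl
  rw [add_comm, pow_add, mul_smul, hm, smul_zero]

lemma eq_of_two_pow_smul {k l : ℕ} {m : M} (hk : (2 ^ (k - 1) : S) • m ≠ 0)
    (hk' : (2 ^ k : S) • m = 0) (hl : (2 ^ (l - 1) : S) • m ≠ 0) (hl' : (2 ^ l : S) • m = 0) :
    k = l := by
  by_contra hne
  rcases Nat.lt_or_gt_of_ne hne with hlt | hlt
  · exact hl (two_pow_smul_of_le (by omega) hk')
  · exact hk (two_pow_smul_of_le (by omega) hl')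

section Uniform

variable {w : S}

/-- If `w` multiplies each vector that it does not kill by a unit times the largest power of `2`
not killing it, then all vectors not killed by `w` have the same order: if `b` had smaller order
than `a`, then subtracting a multiple of `a` from `b` would produce a vector of still smaller order
that is not killed by `w`. -/
lemma le_of_smul_ne_zero (h : EisensteinInvolution x y)
    (hw : ∀ a : M, w • a ≠ 0 → ∃ n, 3 ≤ n ∧ (2 ^ (n - 1) : S) • a ≠ 0 ∧ (2 ^ n : S) • a = 0 ∧
      ∃ ε ∈ ({1, x, x ^ 2} : Set S), w • a = (2 ^ (n - 1) * ε) • a)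
    {n : ℕ} {a : M} (ha : w • a ≠ 0) (hn : (2 ^ (n - 1) : S) • a ≠ 0)
    (hn' : (2 ^ n : S) • a = 0) (m : ℕ) {b : M} (hb : w • b ≠ 0)
    (hm' : (2 ^ m : S) • b = 0) : n ≤ m := by
  induction m using Nat.strong_induction_on generalizing b with
  | _ m ih =>
  by_contra! hmn
  obtain ⟨n₁, h3, hn₁, hn₁', ε, hε, hεa⟩ := hw a ha
  obtain rfl := eq_of_two_pow_smul hn₁ hn₁' hn hn'
  obtain ⟨l, hl3, hl, hl', ε₁, hε₁, hε₁b⟩ := hw b hb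
  have hlm : l ≤ m := by
    by_contra! hlt
    exact hl (two_pow_smul_of_le (by omega) hm')
  have hab : (2 ^ (n₁ - 1) : S) • (a + b) = (2 ^ (n₁ - 1) : S) • a := by
    rw [smul_add, two_pow_smul_of_le (by omega) hm', add_zero]
  have hw2 : (2 * w) • a = 0 := by
    rw [mul_smul, hεa, smul_smul, ← mul_assoc, mul_pow_sub_one (by omega), mul_comm, mul_smul,
      hn', smul_zero]
  -- the multiple `2 ^ (l - 1)` of `b` is also a multiple of `a`
  obtain ⟨ε₂, hε₂⟩ : ∃ ε₂ : S, w • (a + b) = (2 ^ (n₁ - 1) * ε₂) • a := by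
    by_cases hwab : w • (a + b) = 0
    · exact ⟨0, by rw [hwab, mul_zero, zero_smul]⟩
    · obtain ⟨k, -, hk, hk', ε₂, -, hε₂⟩ := hw _ hwab
      obtain rfl := eq_of_two_pow_smul hk hk' (hab ▸ hn) (by
        rw [smul_add, hn', two_pow_smul_of_le (by omega) hm', add_zero])
      exact ⟨ε₂, by rw [hε₂, mul_comm, mul_smul, hab, mul_smul]⟩
  have hunit : IsUnit ε₁ := by
    have := h.eq_or_isUnit_sub (ε := ε₁) (ε' := 0) (Set.mem_insert_of_mem _ hε₁) (by simp)
    rcases this with rfl | hu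
    · rw [mul_zero, zero_smul] at hε₁b
      exact absurd hε₁b hb
    · rwa [sub_zero] at hu
  obtain ⟨u, rfl⟩ := hunit
  have hb2 : (2 ^ (l - 1) : S) • b = (2 ^ (n₁ - 1) * ((ε₂ - ε) * ↑u⁻¹) : S) • a := by
    rw [smul_add, hεa, hε₁b] at hε₂
    have : (2 ^ (l - 1) * (u : S)) • b = (2 ^ (n₁ - 1) * (ε₂ - ε)) • a := by
      linear_combination (norm := module) hε₂
    calc (2 ^ (l - 1) : S) • b = (↑u⁻¹ * (2 ^ (l - 1) * ↑u) : S) • b := by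
            rw [mul_comm, mul_assoc, Units.mul_inv, mul_one]
      _ = _ := by rw [mul_smul, this, smul_smul]; congr 1; ring
  refine absurd (ih (l - 1) (by omega)
    (b := b - (2 ^ (n₁ - l) * ((ε₂ - ε) * ↑u⁻¹) : S) • a) ?_ ?_) (by omega)
  · rw [smul_sub, smul_smul]
    have : (w * (2 ^ (n₁ - l) * ((ε₂ - ε) * ↑u⁻¹)) : S) • a = 0 := by
      obtain ⟨d, hd⟩ : ∃ d, n₁ - l = d + 1 := ⟨n₁ - l - 1, by omega⟩
      rw [hd, show w * (2 ^ (d + 1) * ((ε₂ - ε) * ↑u⁻¹)) =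
        (2 ^ d * ((ε₂ - ε) * ↑u⁻¹)) * (2 * w) by ring, mul_smul, hw2, smul_zero]
    rwa [this, sub_zero]
  · rw [smul_sub, smul_smul, hb2, ← mul_assoc (2 ^ (l - 1)), ← pow_add,
      show l - 1 + (n₁ - l) = n₁ - 1 by omega,
      sub_self]

end Uniform

/-- The two possibilities for the action of `y` when all odd relations for `y` hold and
`2 (y - 1)` does not act as zero. -/
lemma classification (h : EisensteinInvolution x y) (hrel : ∀ a : M, OddRelation x y a)
    {a : M} (ha : (2 * (y - 1)) • a ≠ 0) :
    ∃ ε ∈ ({x, x ^ 2} : Set S), (∀ m : M, (8 : S) • m = 0 ∧ (y + 1) • m = (4 * ε) • m) ∨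
      ∃ n, 3 ≤ n ∧ ∀ m : M, (2 * (y - 1)) • m = (2 ^ (n - 1) * ε) • m := by
  have hpt (a : M) (ha : (2 * (y - 1)) • a ≠ 0) := (h.two_mul_sub_one_smul (hrel a)).resolve_left ha
  have hw : ∀ a : M, (2 * (y - 1)) • a ≠ 0 → ∃ n, 3 ≤ n ∧ (2 ^ (n - 1) : S) • a ≠ 0 ∧
      (2 ^ n : S) • a = 0 ∧
      ∃ ε ∈ ({1, x, x ^ 2} : Set S), (2 * (y - 1)) • a = (2 ^ (n - 1) * ε) • a := by
    intro a ha
    obtain ⟨n, h3, h1, h2, ⟨ε, hε, hεa⟩ | ⟨-, hεa, -⟩⟩ := hpt a ha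
    · exact ⟨n, h3, h1, h2, ε, Set.mem_insert_of_mem _ hε, hεa⟩
    · exact ⟨n, h3, h1, h2, 1, by simp, by rwa [mul_one]⟩
  obtain ⟨n, h3, hn, hn', -⟩ := hw a ha
  have hlevel {m : M} (hm : (2 * (y - 1)) • m ≠ 0) :
      (2 ^ (n - 1) : S) • m ≠ 0 ∧ (2 ^ n : S) • m = 0 := by
    obtain ⟨k, -, hk, hk', -⟩ := hw m hm
    obtain rfl := le_antisymm (h.le_of_smul_ne_zero hw ha hn hn' k hm hk')
      (h.le_of_smul_ne_zero hw hm hk hk' n ha hn')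
    exact ⟨hk, hk'⟩
  have hexp (m : M) : (2 ^ n : S) • m = 0 := by
    by_cases hm : (2 * (y - 1)) • m = 0
    · have := (hlevel (m := a + m) (by rwa [smul_add, hm, add_zero])).2
      rwa [smul_add, hn', zero_add] at this
    · exact (hlevel hm).2
  have hker (m : M) (hm : (2 ^ (n - 1) : S) • m = 0) : (2 * (y - 1)) • m = 0 := by
    by_contra hne
    exact (hlevel hne).1 hm
  obtain ⟨ε, hε, hall⟩ := h.exists_uniform_scalar (E := {0, 1, x, x ^ 2}) le_rfl hn hker (by
    intro m
    by_cases hm : (2 * (y - 1)) • m = 0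
    · exact ⟨0, by simp, by rw [hm, mul_zero, zero_smul]⟩
    · obtain ⟨k, -, hk, hk', ε, hε, hεm⟩ := hw m hm
      obtain rfl := eq_of_two_pow_smul hk hk' (hlevel hm).1 (hlevel hm).2
      exact ⟨ε, Set.mem_insert_of_mem _ hε, hεm⟩)
  rcases hε with rfl | rfl | hε
  · exact absurd (by rw [hall a, mul_zero, zero_smul]) ha
  · -- on every vector of maximal order, `2 (y - 1)` acts as `2 ^ (n - 1)`
    have hpt1 (m : M) (hm : (2 ^ (n - 1) : S) • m ≠ 0) :
        n = 3 ∧ ∃ ε ∈ ({x, x ^ 2} : Set S), (y + 1) • m = (4 * ε) • m := by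
      obtain ⟨k, -, hk, hk', hcase⟩ := hpt m (by rwa [hall m, mul_one])
      obtain rfl := eq_of_two_pow_smul hk hk' hm (hexp m)
      rcases hcase with ⟨ε, hε, hεm⟩ | ⟨hk3, -, hε⟩
      · rw [hall m, ← sub_eq_zero, ← sub_smul, ← mul_sub, mul_comm, mul_smul] at hεm
        rcases h.eq_or_isUnit_sub (ε := 1) (ε' := ε) (by simp) (by
          rcases hε with rfl | rfl <;> simp) with rfl | hu
        · have hu : IsUnit (0 : S) := by
            rcases hε with hε | hε
            · simpa only [← hε, sub_self] using h.isUnit_one_sub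
            · simpa only [← Set.mem_singleton_iff.1 hε, sub_self] using h.symm.isUnit_one_sub
          exact absurd (hu.smul_eq_zero.1 (zero_smul _ _)) hm
        · exact absurd (hu.smul_eq_zero.1 hεm) hm
      · exact ⟨hk3, hε⟩
    obtain ⟨rfl, -⟩ := hpt1 a hn
    simp only [show (2 ^ (3 - 1) : S) = 4 by norm_num, show (2 ^ 3 : S) = 8 by norm_num]
      at hn hpt1 hexp
    have hsub : ({x, x ^ 2} : Set S) ⊆ {0, 1, x, x ^ 2} := fun _ ↦ by simp +contextual
    have hker' (m : M) (hm : (4 : S) • m = 0) : (y + 1) • m = 0 := by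
      -- compare the scalars at `a`, at `a + m` and at `x a + m`
      have hx4 (c : S) : (4 * c) • m = 0 := by rw [mul_comm, mul_smul, hm, smul_zero]
      have hxu : IsUnit x := IsUnit.of_mul_eq_one (x ^ 2) (by linear_combination h.cube)
      obtain ⟨-, ε, hε, hεa⟩ := hpt1 a hn
      obtain ⟨-, ε₁, hε₁, hε₁a⟩ := hpt1 (a + m) (by rwa [smul_add, hm, add_zero])
      obtain ⟨-, ε₂, hε₂, hε₂a⟩ := hpt1 (x • a + m) (by
        rwa [smul_add, hm, add_zero, smul_comm, ne_eq, hxu.smul_eq_zero])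
      have h1 : (y + 1) • m = ((ε₁ - ε) * 4) • a := by
        linear_combination (norm := module) hε₁a - hεa + hx4 ε₁
      have h2 : (y + 1) • m = ((ε₂ - ε) * x * 4) • a := by
        linear_combination (norm := module) hε₂a - x • hεa + hx4 ε₂
      by_cases h01 : ε₁ = ε
      · rw [h1, h01, sub_self, zero_mul, zero_smul]
      by_cases h02 : ε₂ = ε
      · rw [h2, h02, sub_self, zero_mul, zero_mul, zero_smul]
      have h12 : ε₁ = ε₂ := by
        rcases hε with rfl | rfl <;> rcases hε₁ with rfl | rfl <;> rcases hε₂ with rfl | rfl <;>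
          first | rfl | exact absurd rfl h01 | exact absurd rfl h02
      subst h12
      have hu : IsUnit (ε₁ - ε) :=
        (h.eq_or_isUnit_sub (hsub hε₁) (hsub hε)).resolve_left h01
      have h3 : ((1 - x) * (ε₁ - ε) * 4) • a = 0 := by
        linear_combination (norm := module) h2 - h1
      rw [mul_smul, (h.isUnit_one_sub.mul hu).smul_eq_zero] at h3
      exact absurd h3 hn
    obtain ⟨ε, hε, hall'⟩ := h.exists_uniform_scalar (s := y + 1) (σ := 4) (E := {x, x ^ 2}) hsub hn
      hker' (by
        intro m
        by_cases hm : (4 : S) • m = 0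
        · exact ⟨x, by simp, by rw [hker' m hm, mul_comm, mul_smul, hm, smul_zero]⟩
        · exact (hpt1 m hm).2)
    exact ⟨ε, hε, .inl fun m ↦ ⟨hexp m, hall' m⟩⟩
  · exact ⟨ε, hε, .inr ⟨n, h3, hall⟩⟩

end EisensteinInvolution

/-! ### Sums of a character over an orbit -/

namespace EisensteinInvolution

section Ring

variable {S M : Type*} [CommRing S] [AddCommGroup M] [Module S M] {x y : S}

lemma oddRelation_of_eq_zero {z : S} {p q r : ℤ} (hodd : Odd (p + q + r))
    (hrel : (p : S) + q * z + 2 * r * x * (z - 1) = 0) (a : M) : OddRelation x z a :=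
  ⟨p, q, r, hodd, by rw [hrel, zero_smul]⟩

/-- All odd relations hold if `8 = 0` and `y = -1 + 4 x`. -/
lemma oddRelation_of_add_one_eq (h : EisensteinInvolution x y) (h8 : (8 : S) = 0)
    (hy : y + 1 = 4 * x) (a : M) :
    OddRelation x y a ∧ OddRelation x (x * y) a ∧ OddRelation x (x ^ 2 * y) a := by
  have hx := h.sq_add
  obtain rfl : y = 4 * x - 1 := by linear_combination hy
  -- the coefficients are solutions modulo `8` for `z = y`, `z = x y` and `z = x² y`
  refine ⟨oddRelation_of_eq_zero (p := 1) (q := 1) (r := 1) (by decide) ?_ a,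
    oddRelation_of_eq_zero (p := -2) (q := 0) (r := 1) (by decide) ?_ a,
    oddRelation_of_eq_zero (p := 0) (q := 2) (r := 1) (by decide) ?_ a⟩
  · push_cast
    linear_combination x ^ 2 * h8
  · push_cast
    linear_combination -2 * hx + x ^ 3 * h8
  · push_cast
    linear_combination (-2 * x) * hx + (x ^ 3 + x ^ 4) * h8

lemma two_pow_eq_zero_of_eq (h : EisensteinInvolution x y) {n : ℕ} (hn : 3 ≤ n)
    (hy : (2 : S) ^ (n - 1) = 2 * x * (y - 1)) : (2 : S) ^ n = 0 := by
  obtain ⟨k, rfl⟩ : ∃ k, n = k + 3 := ⟨n - 3, by omega⟩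
  rw [show k + 3 - 1 = k + 2 by omega] at hy
  have hu := h.isUnit_add_mul (i := 1 - 2 ^ k) (j := -2 ^ k) (by
    rcases k with _ | k
    · exact .inr (by decide)
    · exact .inl (odd_one.sub_even ⟨2 ^ k, by ring⟩))
  rw [← hu.mul_left_eq_zero]
  have hδ := h.sub_one_sq
  have hx := h.sq_add
  have h3 := h.cube
  push_cast
  linear_combination (y - 1 + 2 + 2 * 2 ^ k * x ^ 2) * hy + 2 * x * hδ +
    4 * 2 ^ k * (y - 1) * h3 - 8 * (2 ^ k) ^ 2 * hx

/-- All odd relations hold if `2 ^ (n - 1) = 2 x (y - 1)` for some `n ≥ 3`. -/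
lemma oddRelation_of_two_pow_eq (h : EisensteinInvolution x y) {n : ℕ} (hn : 3 ≤ n)
    (hy : (2 : S) ^ (n - 1) = 2 * x * (y - 1)) (a : M) :
    OddRelation x y a ∧ OddRelation x (x * y) a ∧ OddRelation x (x ^ 2 * y) a := by
  have h0 := h.two_pow_eq_zero_of_eq hn hy
  obtain ⟨k, rfl⟩ : ∃ k, n = k + 3 := ⟨n - 3, by omega⟩
  rw [show k + 3 - 1 = k + 2 by omega] at hy
  have hx := h.sq_add
  -- the hypothesis itself is the relation for `z = y`
  refine ⟨oddRelation_of_eq_zero (p := -(2 ^ (k + 2))) (q := 0) (r := 1) ?_ ?_ a,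
    oddRelation_of_eq_zero (p := 2) (q := 4 - 2 ^ (k + 2)) (r := 1) ?_ ?_ a,
    oddRelation_of_eq_zero (p := -4 + 2 ^ (k + 2)) (q := -2) (r := 1) ?_ ?_ a⟩
  · exact ⟨-2 ^ (k + 1), by ring⟩
  · push_cast
    linear_combination -hy
  · exact ⟨3 - 2 ^ (k + 1), by ring⟩
  · push_cast
    linear_combination -(2 - 2 * 2 ^ k + x) * hy + 2 * hx + (1 - 2 ^ k) * h0
  · exact ⟨-3 + 2 ^ (k + 1), by ring⟩
  · push_cast
    linear_combination -(x ^ 2 - x) * hy + (2 * x - 4 + 4 * 2 ^ k) * hx - x * h0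

end Ring

end EisensteinInvolution

/-- The sum of the values of an additive character over the orbit of `a` under `x` and `y`. -/
def orbitSum {S M : Type*} [CommRing S] [AddCommGroup M] [Module S M] (x y : S)
    (ψ : AddChar M ℂ) (a : M) : ℂ :=
  ψ a + ψ (x • a) + ψ (x ^ 2 • a) + (ψ (y • a) + ψ ((x * y) • a) + ψ ((x ^ 2 * y) • a))

namespace EisensteinInvolution

variable {S M : Type*} [CommRing S] [AddCommGroup M] [Module S M] {x y : S}

lemma addChar_mul_mul (h : EisensteinInvolution x y) (ψ : AddChar M ℂ) (a : M) :
    ψ a * ψ (x • a) * ψ (x ^ 2 • a) = 1 := by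
  rw [← ψ.map_add_eq_mul, ← ψ.map_add_eq_mul, ← ψ.map_zero_eq_one]
  congr 1
  rw [← zero_smul S a, ← h.sq_add]
  module

lemma orbitSum_eq_zero (h : EisensteinInvolution x y) {ψ : AddChar M ℂ} {a : M}
    (h1 : ψ ((1 - x) • a) = -1) (h2 : ψ ((1 - x) • y • a) = -1)
    (h3 : ψ ((2 * (y - 1)) • a) = -1) : orbitSum x y ψ a = 0 := by
  have e1 := h.addChar_mul_mul ψ a
  have e2 := h.addChar_mul_mul ψ (y • a)
  have f1 : ψ a = -ψ (x • a) := by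
    rw [← neg_one_mul, ← h1, ← ψ.map_add_eq_mul]; congr 1; module
  have f2 : ψ (y • a) = -ψ (x • y • a) := by
    rw [← neg_one_mul, ← h2, ← ψ.map_add_eq_mul]; congr 1; module
  have f3 : ψ (y • a) * ψ (y • a) = -(ψ a * ψ a) := by
    rw [← neg_one_mul, ← h3]
    simp only [← ψ.map_add_eq_mul]
    congr 1; module
  have ha : ψ a ≠ 0 := by
    intro h0
    rw [h0, zero_mul, zero_mul] at e1
    exact zero_ne_one e1
  have key : ψ a ^ 2 * (ψ (x ^ 2 • a) + ψ (x ^ 2 • y • a)) = 0 := by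
    linear_combination -e1 + e2 + ψ a * ψ (x ^ 2 • a) * f1 - ψ (y • a) * ψ (x ^ 2 • y • a) * f2
      + ψ (x ^ 2 • y • a) * f3
  have key' := (mul_eq_zero.1 key).resolve_left (pow_ne_zero 2 ha)
  rw [orbitSum, mul_smul, mul_smul]
  linear_combination f1 + f2 + key'

/-- If `a` satisfies no odd relation then some character takes the value `-1` at the three
elements that make the orbit sum vanish. -/
lemma exists_orbitSum_eq_zero [Finite M] (h : EisensteinInvolution x y) {a : M}
    (ha : ¬ OddRelation x y a) : ∃ ψ : AddChar M ℂ, orbitSum x y ψ a = 0 := by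
  set u := (1 - x) • a with hu
  set v := (1 - x) • y • a with hv
  set w := (2 * (y - 1)) • a with hw
  let K : AddSubgroup M :=
    { carrier := {m | ∃ p q r : ℤ, Even (p + q + r) ∧ m = p • u + q • v + r • w}
      zero_mem' := ⟨0, 0, 0, by simp⟩
      add_mem' := by
        rintro _ _ ⟨p, q, r, ⟨d, hd⟩, rfl⟩ ⟨p', q', r', ⟨d', hd'⟩, rfl⟩
        exact ⟨p + p', q + q', r + r', ⟨d + d', by omega⟩, by module⟩
      neg_mem' := by
        rintro _ ⟨p, q, r, ⟨d, hd⟩, rfl⟩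
        exact ⟨-p, -q, -r, ⟨-d, by omega⟩, by module⟩ }
  have huK : u ∉ K := by
    rintro ⟨p, q, r, he, hpqr⟩
    -- clearing the factor `1 - x` costs multiplication by `1 - x ^ 2`
    refine ha ⟨3 * (p - 1) - 4 * r, 3 * q + 4 * r, r, ?_, ?_⟩
    · obtain ⟨d, hd⟩ := he
      exact ⟨p + q + d - 2, by omega⟩
    · have e : ((((3 * (p - 1) - 4 * r : ℤ) : S) + ((3 * q + 4 * r : ℤ) : S) * y +
          2 * r * x * (y - 1))) =
          (1 - x ^ 2) * ((p - 1) * (1 - x) + q * ((1 - x) * y) + r * (2 * (y - 1))) := by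
        push_cast
        linear_combination (-(p - 1 + q * y) * (x - 2) + 2 * r * (y - 1) : S) * h.sq_add
      rw [e, mul_smul]
      have : (((p - 1) * (1 - x) + q * ((1 - x) * y) + r * (2 * (y - 1)) : S)) • a = 0 := by
        rw [hu, hv, hw] at hpqr
        simp only [← Int.cast_smul_eq_zsmul S] at hpqr
        linear_combination (norm := module) -hpqr
      rw [this, smul_zero]
  obtain ⟨χ, hχ⟩ := (AddChar.exists_apply_ne_zero (a := (u : M ⧸ K))).2 (by
    rwa [ne_eq, QuotientAddGroup.eq_zero_iff])
  let ψ : AddChar M ℂ := χ.compAddMonoidHom (QuotientAddGroup.mk' K)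
  have hK {m : M} (hm : m ∈ K) : ψ m = 1 := by
    have : ψ m = χ (m : M ⧸ K) := rfl
    rw [this, (QuotientAddGroup.eq_zero_iff m).2 hm, χ.map_zero_eq_one]
  have hψu : ψ u = -1 := by
    have h2 : ψ (u + u) = 1 := hK ⟨2, 0, 0, by decide, by module⟩
    rw [ψ.map_add_eq_mul, mul_self_eq_one_iff] at h2
    exact h2.resolve_left hχ
  have hψv : ψ v = -1 := by
    have h2 : ψ (u + v) = 1 := hK ⟨1, 1, 0, by decide, by module⟩
    rw [ψ.map_add_eq_mul, hψu] at h2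
    linear_combination -h2
  have hψw : ψ w = -1 := by
    have h2 : ψ (u + w) = 1 := hK ⟨1, 0, 1, by decide, by module⟩
    rw [ψ.map_add_eq_mul, hψu] at h2
    linear_combination -h2
  exact ⟨ψ, h.orbitSum_eq_zero hψu hψv hψw⟩

end EisensteinInvolution

/-! ### Vanishing sums of roots of unity of 2-power order -/

open Polynomial in
/-- In a vanishing sum of roots of unity of `2`-power order, the negative of each term is a term:
after division by that term, the powers of a primitive `2 ^ (K + 1)`-th root of unity with exponent
below `2 ^ K` are linearly independent over `ℚ`, and `1` has to be cancelled by `-1`. -/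
theorem exists_eq_neg_of_sum_eq_zero {ι : Type*} {s : Finset ι} {f : ι → ℂ} {N : ℕ}
    (hf : ∀ i ∈ s, f i ^ 2 ^ N = 1) (hsum : ∑ i ∈ s, f i = 0) {i : ι} (hi : i ∈ s) :
    ∃ j ∈ s, f j = -f i := by
  by_contra! hne
  have hi0 : f i ≠ 0 := fun h0 ↦ by simpa [h0] using hf i hi
  rcases N with _ | K
  · have : ∑ j ∈ s, f j = s.card := by
      rw [Finset.sum_congr rfl fun j hj ↦ by simpa using hf j hj]
      simp
    rw [this, Nat.cast_eq_zero, Finset.card_eq_zero] at hsum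
    simp [hsum] at hi
  have hζ := Complex.isPrimitiveRoot_exp (2 ^ (K + 1)) (by positivity)
  set ζ := Complex.exp (2 * Real.pi * Complex.I / (2 ^ (K + 1) : ℕ)) with hζdef
  have hhalf : ζ ^ 2 ^ K = -1 := by
    have h2 : (ζ ^ 2 ^ K) ^ 2 = 1 := by rw [← pow_mul, ← pow_succ, hζ.pow_eq_one]
    rw [sq, mul_self_eq_one_iff] at h2
    exact h2.resolve_left <| hζ.pow_ne_one_of_pos_of_lt (by positivity)
      (Nat.pow_lt_pow_right (by omega) (by omega))
  have hexp (j : ι) : ∃ e < 2 ^ (K + 1), j ∈ s → ζ ^ e = f j / f i := by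
    by_cases hj : j ∈ s
    · obtain ⟨e, he, hej⟩ := hζ.eq_pow_of_pow_eq_one (ξ := f j / f i) (by
        rw [div_pow, hf j hj, hf i hi, div_one])
      exact ⟨e, he, fun _ ↦ hej⟩
    · exact ⟨0, by positivity, fun h ↦ absurd h hj⟩
  choose e he hej using hexp
  -- reduce the exponents modulo `2 ^ K`, at the cost of a sign
  let c (j : ι) : ℚ := if e j < 2 ^ K then 1 else -1
  let P : ℚ[X] := ∑ j ∈ s, C (c j) * X ^ (e j % 2 ^ K)
  have hterm (j : ι) : (c j : ℂ) * ζ ^ (e j % 2 ^ K) = ζ ^ e j := by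
    by_cases hlt : e j < 2 ^ K
    · simp [c, hlt, Nat.mod_eq_of_lt hlt]
    · have h1 : e j = 2 ^ K + e j % 2 ^ K := by
        have h2 := he j
        rw [pow_succ] at h2
        rw [Nat.mod_eq_sub_mod (by omega), Nat.mod_eq_of_lt (by omega)]
        omega
      conv_rhs => rw [h1, pow_add, hhalf]
      simp [c, hlt]
  have hP0 : aeval ζ P = 0 := by
    have : aeval ζ P = ∑ j ∈ s, f j / f i := by
      simp only [P, map_sum, map_mul, aeval_C, map_pow, aeval_X, eq_ratCast]
      exact Finset.sum_congr rfl fun j hj ↦ by rw [hterm, hej j hj]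
    rw [this, ← Finset.sum_div, hsum, zero_div]
  have hcoeff : 0 < P.coeff 0 := by
    simp only [P, finsetSum_coeff, coeff_C_mul, coeff_X_pow]
    refine Finset.sum_pos' (fun j hj ↦ ?_) ⟨i, hi, ?_⟩
    · by_cases h0 : 0 = e j % 2 ^ K
      · have hlt : e j < 2 ^ K := by
          by_contra hge
          have h1 := hterm j
          rw [← h0, pow_zero, mul_one, hej j hj] at h1
          simp only [c, hge, if_false] at h1
          refine hne j hj ?_
          rw [eq_comm, div_eq_iff hi0] at h1
          simpa using h1
        simp [c, hlt, h0]
      · simp [h0]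
    · have h0 : e i = 0 := by
        have h1 := hej i hi
        rw [div_self hi0] at h1
        by_contra hpos
        exact hζ.pow_ne_one_of_pos_of_lt hpos (he i) h1
      simp [c, h0]
  have hPne : P ≠ 0 := fun h0 ↦ by simp [h0] at hcoeff
  have hdeg := natDegree_le_natDegree (minpoly.degree_le_of_ne_zero ℚ ζ hPne hP0)
  rw [← cyclotomic_eq_minpoly_rat hζ (by positivity), natDegree_cyclotomic,
    Nat.totient_prime_pow_succ Nat.prime_two, show 2 - 1 = 1 from rfl, mul_one] at hdeg
  have hlt : P.natDegree < 2 ^ K := by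
    refine (natDegree_lt_iff_degree_lt hPne).2 ?_
    refine (degree_sum_le _ _).trans_lt ((Finset.sup_lt_iff (WithBot.bot_lt_coe _)).2 fun j _ ↦ ?_)
    refine (degree_C_mul_X_pow_le _ _).trans_lt ?_
    exact_mod_cast Nat.mod_lt _ (by positivity)
  omega

/-- The six-term case of `exists_eq_neg_of_sum_eq_zero`. -/
lemma eq_neg_of_sum_six_eq_zero {a b c d e f : ℂ} {N : ℕ} (ha : a ^ 2 ^ N = 1)
    (hb : b ^ 2 ^ N = 1) (hc : c ^ 2 ^ N = 1) (hd : d ^ 2 ^ N = 1) (he : e ^ 2 ^ N = 1)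
    (hf : f ^ 2 ^ N = 1) (hsum : a + b + c + d + e + f = 0) :
    b = -a ∨ c = -a ∨ d = -a ∨ e = -a ∨ f = -a := by
  have ha0 : a ≠ 0 := fun h0 ↦ by simp [h0] at ha
  obtain ⟨j, -, hj⟩ := exists_eq_neg_of_sum_eq_zero (s := Finset.univ)
    (f := ![a, b, c, d, e, f]) (N := N) (i := 0)
    (by simp [Fin.forall_fin_succ, ha, hb, hc, hd, he, hf])
    (by simp [Fin.sum_univ_succ]; linear_combination hsum) (Finset.mem_univ _)
  fin_cases j
  · exact absurd (self_eq_neg.1 hj) ha0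
  all_goals simp at hj; simp [hj]

/-- The four-term case of `exists_eq_neg_of_sum_eq_zero`. -/
lemma eq_neg_of_sum_four_eq_zero {a b c d : ℂ} {N : ℕ} (ha : a ^ 2 ^ N = 1)
    (hb : b ^ 2 ^ N = 1) (hc : c ^ 2 ^ N = 1) (hd : d ^ 2 ^ N = 1) (hsum : a + b + c + d = 0) :
    b = -a ∨ c = -a ∨ d = -a := by
  have ha0 : a ≠ 0 := fun h0 ↦ by simp [h0] at ha
  obtain ⟨j, -, hj⟩ := exists_eq_neg_of_sum_eq_zero (s := Finset.univ)
    (f := ![a, b, c, d]) (N := N) (i := 0)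
    (by simp [Fin.forall_fin_succ, ha, hb, hc, hd])
    (by simp [Fin.sum_univ_succ]; linear_combination hsum) (Finset.mem_univ _)
  fin_cases j
  · exact absurd (self_eq_neg.1 hj) ha0
  all_goals simp at hj; simp [hj]

namespace EisensteinInvolution

variable {S M : Type*} [CommRing S] [AddCommGroup M] [Module S M] {x y : S}

/-- The matching of the orbit of `a` that pairs `a` with `x a`, `z a` with `x z a` and `x² a` with
`x² z a` is excluded by the odd relation for `z`. -/
lemma not_matching (h : EisensteinInvolution x y) (ψ : AddChar M ℂ) {z : S} {a : M}
    (hrel : OddRelation x z a) (h1 : ψ a = -ψ (x • a)) (h2 : ψ (z • a) = -ψ (x • z • a))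
    (h3 : ψ (x ^ 2 • a) = -ψ (x ^ 2 • z • a)) : False := by
  obtain ⟨p, q, r, hodd, hpqr⟩ := hrel
  have e1 := h.addChar_mul_mul ψ a
  have e2 := h.addChar_mul_mul ψ (z • a)
  have hne (m : M) : ψ m ≠ 0 := fun h0 ↦ by
    have := ψ.map_add_eq_mul m (-m)
    simp [h0] at this
  have hu : ψ ((1 - x) • a) = -1 := by
    refine mul_right_cancel₀ (hne (x • a)) ?_
    rw [← ψ.map_add_eq_mul, neg_one_mul, ← h1]
    congr 1; module
  have hv : ψ ((1 - x) • z • a) = -1 := by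
    refine mul_right_cancel₀ (hne (x • z • a)) ?_
    rw [← ψ.map_add_eq_mul, neg_one_mul, ← h2]
    congr 1; module
  have hw : ψ ((2 * (z - 1)) • a) = -1 := by
    have h4 : ψ (z • a) ^ 2 = - ψ a ^ 2 := by
      refine mul_right_cancel₀ (hne (x ^ 2 • a)) ?_
      linear_combination (-ψ (z • a) * ψ (x ^ 2 • z • a)) * h2 + ψ (z • a) ^ 2 * h3 + e2 - e1 +
        ψ a * ψ (x ^ 2 • a) * h1
    refine mul_right_cancel₀ (pow_ne_zero 2 (hne a)) ?_
    rw [neg_one_mul, ← h4, sq, sq, ← ψ.map_add_eq_mul, ← ψ.map_add_eq_mul, ← ψ.map_add_eq_mul]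
    congr 1; module
  have hcomb : (p + 4 * r) • ((1 - x) • a) + (q - 4 * r) • ((1 - x) • z • a) +
      (3 * r) • ((2 * (z - 1)) • a) = 0 := by
    have e : ((p + 4 * r) * (1 - x) + (q - 4 * r) * ((1 - x) * z) + 3 * r * (2 * (z - 1)) : S) =
        (1 - x) * (p + q * z + 2 * r * x * (z - 1)) := by
      linear_combination (2 * r * (z - 1)) * h.sq_add
    have := congrArg (· • a) e
    simp only [mul_smul _ (_ + _ + _) a, hpqr, smul_zero] at this
    simp only [← Int.cast_smul_eq_zsmul S]
    push_cast
    linear_combination (norm := module) this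
  have := congrArg ψ hcomb
  rw [ψ.map_add_eq_mul, ψ.map_add_eq_mul, ψ.map_zsmul_eq_zpow, ψ.map_zsmul_eq_zpow,
    ψ.map_zsmul_eq_zpow, hu, hv, hw, ψ.map_zero_eq_one, ← zpow_add₀ (by norm_num),
    ← zpow_add₀ (by norm_num), Odd.neg_one_zpow] at this
  · norm_num at this
  · obtain ⟨d, hd⟩ := hodd
    exact ⟨d + r, by omega⟩

/-- If all odd relations hold then no orbit sum vanishes. Of the fifteen ways to match six terms
with their negatives, those without a match inside the orbit of `a` under `x` contradict the
product formula `addChar_mul_mul`, and the other nine are excluded by odd relations. -/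
lemma orbitSum_ne_zero (h : EisensteinInvolution x y)
    (hrel : ∀ a : M, OddRelation x y a ∧ OddRelation x (x * y) a ∧ OddRelation x (x ^ 2 * y) a)
    (ψ : AddChar M ℂ) (a : M) : orbitSum x y ψ a ≠ 0 := by
  intro hsum
  obtain ⟨N, hN⟩ := h.nil
  have hroot (m : M) : ψ m ^ 2 ^ N = 1 := by
    rw [← ψ.map_nsmul_eq_pow, ← Nat.cast_smul_eq_nsmul S]
    push_cast
    rw [hN, zero_smul, ψ.map_zero_eq_one]
  set A : ℕ → ℂ := fun i ↦ ψ (x ^ i • a) with hA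
  set B : ℕ → ℂ := fun i ↦ ψ (x ^ i • y • a) with hB
  have hA3 (i : ℕ) : A (i + 3) = A i := by simp only [hA, pow_add, h.cube, mul_one]
  have hB3 (i : ℕ) : B (i + 3) = B i := by simp only [hB, pow_add, h.cube, mul_one]
  have hA1 (i : ℕ) : A i ^ 2 ^ N = 1 := hroot _
  have hB1 (i : ℕ) : B i ^ 2 ^ N = 1 := hroot _
  have hsum' : A 0 + A 1 + A 2 + B 0 + B 1 + B 2 = 0 := by
    simp only [hA, hB, pow_zero, pow_one, one_smul]
    rw [orbitSum, mul_smul, mul_smul] at hsum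
    linear_combination hsum
  have hAprod : A 0 * A 1 * A 2 = 1 := by
    simpa only [hA, pow_zero, pow_one, one_smul] using h.addChar_mul_mul ψ a
  have hBprod : B 0 * B 1 * B 2 = 1 := by
    simpa only [hB, pow_zero, pow_one, one_smul] using h.addChar_mul_mul ψ (y • a)
  have hkey (i m : ℕ) (hm : m < 3) (h1 : A i = -A (i + 1)) (h2 : B (i + m) = -B (i + m + 1))
      (h3 : A (i + 2) = -B (i + m + 2)) : False := by
    refine h.not_matching ψ (z := x ^ m * y) (a := x ^ i • a) ?_ ?_ ?_ ?_
    · interval_cases m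
      · simpa using (hrel (x ^ i • a)).1
      · simpa using (hrel (x ^ i • a)).2.1
      · exact (hrel (x ^ i • a)).2.2
    · exact Eq.trans h1 (by simp only [hA]; congr 2; module)
    · rw [show (x ^ m * y) • x ^ i • a = x ^ (i + m) • y • a by module]
      exact Eq.trans h2 (by simp only [hB]; congr 2; module)
    · rw [show x ^ 2 • x ^ i • a = x ^ (i + 2) • a by module]
      exact Eq.trans h3 (by simp only [hB]; congr 2; module)
  have hkey' (i k : ℕ) (hi : i < 3) (hk : k < 3) (h1 : A i = -A (i + 1)) (h2 : B k = -B (k + 1))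
      (h3 : A (i + 2) = -B (k + 2)) : False := by
    rcases le_or_gt i k with hik | hik
    · obtain ⟨m, rfl⟩ := Nat.exists_eq_add_of_le hik
      exact hkey i m (by omega) h1 h2 h3
    · obtain ⟨m, hm⟩ := Nat.exists_eq_add_of_le (show i ≤ k + 3 by omega)
      refine hkey i m (by omega) h1 ?_ ?_
      · rw [← hm, add_right_comm, hB3, hB3, h2]
      · rw [← hm, add_right_comm, hB3, h3]
  have a3 : A 3 = A 0 := hA3 0
  have a4 : A 4 = A 1 := hA3 1
  have b3 : B 3 = B 0 := hB3 0
  have b4 : B 4 = B 1 := hB3 1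
  have hinner (i : ℕ) (hi : i < 3) (h1 : A i = -A (i + 1))
      (h2 : A (i + 2) + B 0 + B 1 + B 2 = 0) : False := by
    rcases eq_neg_of_sum_four_eq_zero (hA1 _) (hB1 _) (hB1 _) (hB1 _) h2 with h3 | h3 | h3
    · exact hkey' i 1 hi (by omega) h1 (by linear_combination h2 - h3)
        (by linear_combination h3 + b3)
    · exact hkey' i 2 hi (by omega) h1 (by linear_combination h2 - h3 + b3)
        (by linear_combination h3 + b4)
    · exact hkey' i 0 hi (by omega) h1 (by linear_combination h2 - h3)
        (by linear_combination h3)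
  have hcross {b₀ b₁ b₂ : ℂ} (hb : b₀ * b₁ * b₂ = 1) (h0 : b₀ = -A 0) (h1 : b₁ = -A 1)
      (h2 : b₂ = -A 2) : False := by
    have : (1 : ℂ) = -1 := by
      rw [h0, h1, h2] at hb
      linear_combination -hb - hAprod
    norm_num at this
  rcases eq_neg_of_sum_six_eq_zero (hA1 _) (hA1 _) (hA1 _) (hB1 _) (hB1 _) (hB1 _) hsum'
    with h0 | h0 | h0 | h0 | h0
  · exact hinner 0 (by omega) (by linear_combination h0) (by linear_combination hsum' - h0)
  · exact hinner 2 (by omega) (by linear_combination h0 + a3)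
      (by linear_combination hsum' - h0 + a4)
  · rcases eq_neg_of_sum_four_eq_zero (hA1 1) (hA1 2) (hB1 1) (hB1 2)
      (by linear_combination hsum' - h0) with h1 | h1 | h1
    · exact hinner 1 (by omega) (by linear_combination h1)
        (by linear_combination hsum' - h1 + a3)
    · exact hcross hBprod h0 h1 (by linear_combination hsum' - h0 - h1)
    · exact hcross (b₁ := B 2) (b₂ := B 1) (by linear_combination hBprod) h0 h1
        (by linear_combination hsum' - h0 - h1)
  · rcases eq_neg_of_sum_four_eq_zero (hA1 1) (hA1 2) (hB1 0) (hB1 2)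
      (by linear_combination hsum' - h0) with h1 | h1 | h1
    · exact hinner 1 (by omega) (by linear_combination h1)
        (by linear_combination hsum' - h1 + a3)
    · exact hcross (b₀ := B 1) (b₁ := B 0) (b₂ := B 2) (by linear_combination hBprod) h0 h1
        (by linear_combination hsum' - h0 - h1)
    · exact hcross (b₀ := B 1) (b₁ := B 2) (b₂ := B 0) (by linear_combination hBprod) h0 h1
        (by linear_combination hsum' - h0 - h1)
  · rcases eq_neg_of_sum_four_eq_zero (hA1 1) (hA1 2) (hB1 0) (hB1 1)
      (by linear_combination hsum' - h0) with h1 | h1 | h1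
    · exact hinner 1 (by omega) (by linear_combination h1)
        (by linear_combination hsum' - h1 + a3)
    · exact hcross (b₀ := B 2) (b₁ := B 0) (b₂ := B 1) (by linear_combination hBprod) h0 h1
        (by linear_combination hsum' - h0 - h1)
    · exact hcross (b₀ := B 2) (b₁ := B 1) (b₂ := B 0) (by linear_combination hBprod) h0 h1
        (by linear_combination hsum' - h0 - h1)

end EisensteinInvolution

/-! ### Socles and free direct summands -/

/-- Extracting the common power of `2` from two integers. -/
lemma Int.exists_two_pow_mul_odd_or (n : ℕ) (i j : ℤ) :
    (2 ^ n ∣ i ∧ 2 ^ n ∣ j) ∨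
      ∃ e < n, ∃ i' j' : ℤ, (Odd i' ∨ Odd j') ∧ i = 2 ^ e * i' ∧ j = 2 ^ e * j' := by
  induction n generalizing i j with
  | zero => simp
  | succ n ih =>
    by_cases hodd : Odd i ∨ Odd j
    · exact .inr ⟨0, by omega, i, j, hodd, by simp, by simp⟩
    · rw [not_or, Int.not_odd_iff_even, Int.not_odd_iff_even] at hodd
      obtain ⟨i, rfl⟩ := hodd.1.two_dvd
      obtain ⟨j, rfl⟩ := hodd.2.two_dvd
      rcases ih i j with ⟨⟨a, ha⟩, ⟨b, hb⟩⟩ | ⟨e, he, i', j', hodd', hi, hj⟩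
      · exact .inl ⟨⟨a, by rw [ha]; ring⟩, ⟨b, by rw [hb]; ring⟩⟩
      · exact .inr ⟨e + 1, by omega, i', j', hodd', by rw [hi]; ring, by rw [hj]; ring⟩

namespace EisensteinInvolution

section

variable {S M : Type*} [CommRing S] [AddCommGroup M] [Module S M] {x y : S}

/-- If `m` has order `2 ^ n` then `m` and `x m` are independent elements of this order. -/
lemma two_pow_dvd_of_smul_eq_zero (h : EisensteinInvolution x y) {n : ℕ} {m : M}
    (hm : (2 ^ (n - 1) : S) • m ≠ 0) {i j : ℤ}
    (hij : ((i : S) + j * x) • m = 0) : 2 ^ n ∣ i ∧ 2 ^ n ∣ j := by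
  rcases Int.exists_two_pow_mul_odd_or n i j with hd | ⟨e, he, i', j', hodd, rfl, rfl⟩
  · exact hd
  · have hu := h.isUnit_add_mul hodd
    have h0 : (2 ^ e : S) • m = 0 := by
      rw [← hu.smul_eq_zero, smul_smul, ← hij]
      congr 1
      push_cast
      ring
    exact absurd (two_pow_smul_of_le (by omega) h0) hm

end

variable {S : Type*} [CommRing S] {x y : S}

/-- If `2 ^ n = 0` then each nonzero Eisenstein integer divides `2 ^ (n - 1)`. -/
lemma exists_mul_add_mul_eq (h : EisensteinInvolution x y) {n : ℕ} (hn : (2 : S) ^ n = 0)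
    {i j : ℤ} (hij : (i : S) + j * x ≠ 0) : ∃ t, t * ((i : S) + j * x) = 2 ^ (n - 1) := by
  rcases Int.exists_two_pow_mul_odd_or n i j with
    ⟨⟨i', rfl⟩, ⟨j', rfl⟩⟩ | ⟨e, he, i', j', hodd, rfl, rfl⟩
  · push_cast at hij
    simp [hn] at hij
  · obtain ⟨u, hu⟩ := h.isUnit_add_mul hodd
    refine ⟨2 ^ (n - 1 - e) * ↑u⁻¹, ?_⟩
    push_cast
    calc _ = 2 ^ (n - 1 - e) * 2 ^ e * (↑u⁻¹ * ((i' : S) + j' * x)) := by ring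
      _ = _ := by rw [← hu, Units.inv_mul, mul_one, ← pow_add]; congr 1; omega

/-- The ideal generated by `4` is contained in each nonzero ideal if `8 = 0` and
`y = -1 + 4 x`. -/
lemma exists_mul_eq_four (h : EisensteinInvolution x y) (h8 : (8 : S) = 0) (hy : y + 1 = 4 * x)
    {s : S} (hs : s ≠ 0) : ∃ t, t * s = 2 ^ 2 := by
  obtain ⟨i, j, k, l, rfl⟩ := h.gen s
  have e : (i : S) + j * x + (k + l * x) * y =
      ((i - k - 4 * l : ℤ) : S) + ((j - l + 4 * k - 4 * l : ℤ) : S) * x := by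
    push_cast
    linear_combination (k + l * x) * hy + 4 * l * h.sq_add
  rw [e] at hs ⊢
  exact h.exists_mul_add_mul_eq (n := 3) (by linear_combination h8) hs

/-- The ideal generated by `2 ^ (n - 1)` is contained in each nonzero ideal if `n ≥ 3` and
`2 ^ (n - 1) = 2 x (y - 1)`. -/
lemma exists_mul_eq_two_pow (h : EisensteinInvolution x y) {n : ℕ} (hn : 3 ≤ n)
    (hy : (2 : S) ^ (n - 1) = 2 * x * (y - 1)) (h0 : (2 : S) ^ (n - 1) ≠ 0)
    {s : S} (hs : s ≠ 0) : ∃ t, t * s = 2 ^ (n - 1) := by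
  have hn0 := h.two_pow_eq_zero_of_eq hn hy
  have hx := h.sq_add
  have h3 := h.cube
  obtain ⟨r, rfl⟩ : ∃ r, n = r + 3 := ⟨n - 3, by omega⟩
  have hy' : (2 : S) ^ (r + 2) = 2 * x * (y - 1) := hy
  obtain ⟨i, j, k, l, hs'⟩ : ∃ i j k l : ℤ, s = i + j * x + (k + l * x) * (y - 1) := by
    obtain ⟨i, j, k, l, rfl⟩ := h.gen s
    exact ⟨i + k, j + l, k, l, by push_cast; ring⟩
  -- an even multiple of `y - 1` lies in the subring generated by `x`
  have h2s (k l : ℤ) : (k + l * x) * (2 * (y - 1)) =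
      ((2 ^ (r + 2) * (l - k) : ℤ) : S) + ((-2 ^ (r + 2) * k : ℤ) : S) * x := by
    push_cast
    linear_combination (-(k + l * x) * x ^ 2) * hy' - (k + l * x) * 2 * (y - 1) * h3 +
      2 ^ (r + 2) * (k + l * x - l) * hx
  by_cases hodd : Odd k ∨ Odd l
  swap
  · rw [not_or, Int.not_odd_iff_even, Int.not_odd_iff_even] at hodd
    obtain ⟨k, rfl⟩ := hodd.1.two_dvd
    obtain ⟨l, rfl⟩ := hodd.2.two_dvd
    have e : s = ((i + 2 ^ (r + 2) * (l - k) : ℤ) : S) +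
        ((j - 2 ^ (r + 2) * k : ℤ) : S) * x := by
      have := h2s k l
      push_cast at this ⊢
      push_cast at hs'
      linear_combination hs' + this
    rw [e] at hs ⊢
    exact h.exists_mul_add_mul_eq hn0 hs
  have e : 2 * s = ((2 * i + 2 ^ (r + 2) * (l - k) : ℤ) : S) +
      ((2 * j - 2 ^ (r + 2) * k : ℤ) : S) * x := by
    have := h2s k l
    push_cast at this ⊢
    linear_combination 2 * hs' + this
  by_cases h20 : 2 * s = 0
  swap
  · rw [e] at h20
    obtain ⟨t, ht⟩ := h.exists_mul_add_mul_eq hn0 h20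
    rw [← e] at ht
    exact ⟨t * 2, by rw [mul_assoc, ht]⟩
  -- otherwise `(y - 1) s` is a unit times `2 ^ (n - 1)`
  rw [h20] at e
  obtain ⟨⟨i', hi'⟩, ⟨j', hj'⟩⟩ := h.two_pow_dvd_of_smul_eq_zero (n := r + 3) (m := (1 : S))
    (by simpa using h0) (by rw [← e, zero_smul])
  obtain rfl : i = 2 ^ (r + 1) * (k - l + 2 * i') := by
    refine mul_left_cancel₀ (two_ne_zero (α := ℤ)) ?_
    linear_combination hi'
  obtain rfl : j = 2 ^ (r + 1) * (k + 2 * j') := by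
    refine mul_left_cancel₀ (two_ne_zero (α := ℤ)) ?_
    linear_combination hj'
  obtain ⟨u, hu⟩ := h.isUnit_add_mul hodd
  obtain ⟨v, hv⟩ := h.isUnit_add_mul (i := -1) (j := 2 ^ r - 1) (.inl (by decide))
  have key : (y - 1) * s = -(u * v) * 2 ^ (r + 2) := by
    have hδ := h.sub_one_sq
    have hD : 2 * (y - 1) = x ^ 2 * 2 ^ (r + 2) := by
      linear_combination (-x ^ 2) * hy' - 2 * (y - 1) * h3
    rw [hs', hu, hv]
    push_cast
    linear_combination (2 ^ r * (k - l + k * x) + 2 ^ (r + 1) * (i' + j' * x) - (k + l * x)) * hD +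
      (k + l * x) * hδ + 2 ^ r * (i' + j' * x) * x ^ 2 * hn0 +
      2 ^ (r + 2) * (2 ^ r * k * x - (k + l * x)) * hx
  refine ⟨-(↑u⁻¹ * ↑v⁻¹) * (y - 1), ?_⟩
  rw [mul_assoc, key]
  calc _ = (↑u⁻¹ * ↑u) * (↑v⁻¹ * ↑v) * (2 : S) ^ (r + 2) := by ring
    _ = _ := by rw [Units.inv_mul, Units.inv_mul]; simp

end EisensteinInvolution

section Frobenius

variable {S M : Type*} [CommRing S] [AddCommGroup M] [Module S M] {σ : S}

lemma eq_zero_of_smul_eq_zero (hσ : ∀ s : S, s ≠ 0 → ∃ t, t * s = σ) {b : M} (hb : σ • b ≠ 0)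
    {s : S} (hs : s • b = 0) : s = 0 := by
  by_contra hne
  obtain ⟨t, rfl⟩ := hσ s hne
  exact hb (by rw [mul_smul, hs, smul_zero])

/-- Over a finite ring all of whose nonzero ideals contain `σ`, a cyclic module not killed by `σ`
is a direct summand of each finite module containing it. A complement consists of the elements
`m` such that a character that is nontrivial at `σ b` is trivial on `S m`. -/
lemma exists_complement_span_singleton [Finite S] [Finite M]
    (hσ : ∀ s : S, s ≠ 0 → ∃ t, t * s = σ) {N : Submodule S M} {b : M} (hbN : b ∈ N)
    (hb : σ • b ≠ 0) :
    ∃ C ≤ N, Submodule.span S {b} ⊓ C = ⊥ ∧ Submodule.span S {b} ⊔ C = N := by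
  obtain ⟨ψ, hψ⟩ := (AddChar.exists_apply_ne_zero (a := σ • b)).2 hb
  let T : Submodule S M :=
    { carrier := {m | ∀ t : S, ψ (t • m) = 1}
      zero_mem' := fun t ↦ by rw [smul_zero, ψ.map_zero_eq_one]
      add_mem' := fun ha hb t ↦ by rw [smul_add, ψ.map_add_eq_mul, ha, hb, one_mul]
      smul_mem' := fun s m hm t ↦ by rw [smul_smul]; exact hm _ }
  have hT {m : M} : m ∈ T ↔ ∀ t : S, ψ (t • m) = 1 := Iff.rfl
  refine ⟨T ⊓ N, inf_le_right, ?_, ?_⟩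
  · rw [eq_bot_iff]
    rintro m ⟨hm, hmT, -⟩
    obtain ⟨s, rfl⟩ := Submodule.mem_span_singleton.1 hm
    by_cases hs : s = 0
    · simp [hs]
    · obtain ⟨t, rfl⟩ := hσ s hs
      exact absurd (by rw [mul_smul]; exact hT.1 hmT t) hψ
  · refine le_antisymm (sup_le ((Submodule.span_singleton_le_iff_mem _ _).2 hbN) inf_le_right) ?_
    intro m hm
    -- by counting, all characters of `S` have the form `t ↦ ψ (t s b)`
    let θ (m : M) : AddChar S ℂ :=
      ψ.compAddMonoidHom ((LinearMap.toSpanSingleton S M m).toAddMonoidHom)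
    have hθ (m : M) (t : S) : θ m t = ψ (t • m) := rfl
    have hinj : Function.Injective fun s : S ↦ θ (s • b) := by
      intro s s' hss
      by_contra hne
      obtain ⟨t, ht⟩ := hσ (s - s') (sub_ne_zero.2 hne)
      refine hψ ?_
      have h1 := DFunLike.congr_fun hss t
      simp only [hθ] at h1
      rw [← ht, mul_smul, sub_smul, smul_sub, ψ.map_sub_eq_div, h1, div_self]
      intro h0
      have := ψ.map_add_eq_mul (t • s' • b) (-(t • s' • b))
      simp [h0] at this
    have hbij : Function.Bijective fun s : S ↦ θ (s • b) := by
      cases nonempty_fintype S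
      exact (Fintype.bijective_iff_injective_and_card _).2 ⟨hinj, AddChar.card_eq.symm⟩
    obtain ⟨s, hs⟩ := hbij.2 (θ m)
    refine Submodule.mem_sup.2 ⟨s • b, Submodule.mem_span_singleton.2 ⟨s, rfl⟩, m - s • b,
      ⟨fun t ↦ ?_, N.sub_mem hm (N.smul_mem s hbN)⟩, by abel⟩
    have h1 := DFunLike.congr_fun hs t
    simp only [hθ] at h1
    rw [smul_sub, ψ.map_sub_eq_div, h1, div_self]
    intro h0
    have := ψ.map_add_eq_mul (t • m) (-(t • m))
    simp [h0] at this

/-- Over a finite ring all of whose nonzero ideals contain `σ`, a finite module is the direct sum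
of a free module and a module killed by `σ`. -/
theorem exists_free_sup_torsion [Finite S] [Finite M] (hσ : ∀ s : S, s ≠ 0 → ∃ t, t * s = σ)
    (N : Submodule S M) : ∃ (k : ℕ) (b : Fin k → M) (C : Submodule S M), LinearIndependent S b ∧
      Submodule.span S (Set.range b) ⊓ C = ⊥ ∧ Submodule.span S (Set.range b) ⊔ C = N ∧
      ∀ c ∈ C, σ • c = 0 := by
  induction hcard : Nat.card N using Nat.strong_induction_on generalizing N with
  | _ d ih =>
  by_cases hN : ∀ c ∈ N, σ • c = 0
  · exact ⟨0, Fin.elim0, N, linearIndependent_empty_type, by simp, by simp, hN⟩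
  push Not at hN
  obtain ⟨b, hbN, hb⟩ := hN
  obtain ⟨C, hCN, hinf, hsup⟩ := exists_complement_span_singleton hσ hbN hb
  have hlt : Nat.card C < d := by
    rw [← hcard]
    refine Set.Finite.card_lt_card (Set.toFinite _) ?_
    refine lt_of_le_of_ne hCN fun heq ↦ hb ?_
    have hbC : b ∈ C := by
      have : b ∈ (N : Set M) := hbN
      rwa [← heq] at this
    have h0 : b ∈ Submodule.span S {b} ⊓ C := ⟨Submodule.mem_span_singleton_self b, hbC⟩
    rw [hinf, Submodule.mem_bot] at h0
    rw [h0, smul_zero]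
  obtain ⟨k, v, D, hv, hvD, hvD', hD⟩ := ih _ hlt C rfl
  have hvC : Submodule.span S (Set.range v) ≤ C := hvD' ▸ le_sup_left
  have hDC : D ≤ C := hvD' ▸ le_sup_right
  have hrange : Submodule.span S (Set.range (Fin.cons b v : Fin (k + 1) → M)) =
      Submodule.span S {b} ⊔ Submodule.span S (Set.range v) := by
    rw [Fin.range_cons, Submodule.span_insert]
  refine ⟨k + 1, Fin.cons b v, D, ?_, ?_, ?_, hD⟩
  · refine hv.finCons' _ _ fun c z hz hcz ↦ ?_
    refine eq_zero_of_smul_eq_zero hσ hb ?_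
    have h0 : c • b ∈ Submodule.span S {b} ⊓ C := by
      refine ⟨Submodule.mem_span_singleton.2 ⟨c, rfl⟩, ?_⟩
      rw [eq_neg_of_add_eq_zero_left hcz]
      exact C.neg_mem (hvC hz)
    rwa [hinf, Submodule.mem_bot] at h0
  · rw [hrange, eq_bot_iff]
    rintro m ⟨hm, hmD⟩
    obtain ⟨p, hp, q, hq, rfl⟩ := Submodule.mem_sup.1 hm
    have hpC : p ∈ C := by
      have := C.sub_mem (hDC hmD) (hvC hq)
      rwa [add_sub_cancel_right] at this
    have h0 : p ∈ Submodule.span S {b} ⊓ C := ⟨hp, hpC⟩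
    rw [hinf, Submodule.mem_bot] at h0
    rw [← hvD]
    refine ⟨?_, hmD⟩
    rw [h0, zero_add]
    exact hq
  · rw [hrange, sup_assoc, hvD', hsup]

end Frobenius

/-! ### Irreducible representations and eigenvectors of abelian subgroups -/

section CentralCharacter

variable {G : Type*} [Group G] {n : ℕ} {ρ : Representation ℂ G (Fin n → ℂ)}

lemma Representation.IsIrreducible.eq_top_of_invariant (hρ : ρ.IsIrreducible)
    (W : Submodule ℂ (Fin n → ℂ)) (hW : ∀ g, ∀ v ∈ W, ρ g v ∈ W) {v : Fin n → ℂ} (hv : v ∈ W)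
    (hv0 : v ≠ 0) : W = ⊤ := by
  have := hρ.eq_bot_or_eq_top ⟨W, fun g v hv ↦ hW g v hv⟩
  rcases this with h | h
  · have hvW : v ∈ (⟨W, fun g v hv ↦ hW g v hv⟩ : Subrepresentation ρ) := hv
    rw [h] at hvW
    exact absurd hvW hv0
  · exact congrArg Subrepresentation.toSubmodule h

/-- Let `a i` be a finite family of elements that is permuted by conjugation. In an irreducible
representation, the sum of the operators of the `a i` is a scalar by Schur's lemma; its value can be
read off at any common eigenvector of the `a i`, and its trace is the sum of the character
values. -/
lemma sum_character_eq (hρ : ρ.IsIrreducible) {ι : Type*} [Fintype ι] (a : ι → G)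
    (hperm : ∀ g : G, ∃ π : Equiv.Perm ι, ∀ i, g * a i * g⁻¹ = a (π i)) {v : Fin n → ℂ}
    (hv : v ≠ 0) {c : ι → ℂ} (hc : ∀ i, ρ (a i) v = c i • v) :
    ∑ i, ρ.character (a i) = n * ∑ i, c i := by
  set Z : (Fin n → ℂ) →ₗ[ℂ] (Fin n → ℂ) := ∑ i, ρ (a i) with hZ
  have hcomm (g : G) : ρ g ∘ₗ Z = Z ∘ₗ ρ g := by
    obtain ⟨π, hπ⟩ := hperm g
    have h1 : ∑ i, ρ (a i) = ∑ i, ρ (g * a i * g⁻¹) := by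
      simp only [hπ]
      exact (Equiv.sum_comp π fun i ↦ ρ (a i)).symm
    refine LinearMap.ext fun w ↦ ?_
    conv_rhs => rw [hZ, h1]
    simp [hZ]
  have hZv : Z v = (∑ i, c i) • v := by
    simp [hZ, LinearMap.sum_apply, hc, Finset.sum_smul]
  have htop := hρ.eq_top_of_invariant (LinearMap.ker (Z - (∑ i, c i) • LinearMap.id))
    (fun g w hw ↦ by
      rw [LinearMap.mem_ker, LinearMap.sub_apply, sub_eq_zero] at hw ⊢
      have := LinearMap.congr_fun (hcomm g) w
      simp only [LinearMap.comp_apply] at this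
      rw [← this, hw]
      simp)
    (v := v) (by rw [LinearMap.mem_ker, LinearMap.sub_apply, hZv]; simp) hv
  rw [LinearMap.ker_eq_top, sub_eq_zero] at htop
  have htr := congrArg (LinearMap.trace ℂ (Fin n → ℂ)) htop
  rw [hZ, map_sum, map_smul, LinearMap.trace_id] at htr
  simp only [Module.finrank_fin_fun, smul_eq_mul] at htr
  rw [mul_comm, ← htr]
  rfl

end CentralCharacter

section Weights

variable {G : Type*} [Group G] {B : Type*} [AddCommGroup B] [Finite B]

/-- A finite abelian group acting on a nonzero complex vector space has a common eigenvector. -/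
lemma exists_common_eigenvector {V : Type*} [AddCommGroup V] [Module ℂ V] [Nontrivial V]
    (τ : Multiplicative B →* Module.End ℂ V) :
    ∃ (ψ : AddChar B ℂ) (v : V), v ≠ 0 ∧ ∀ b : B, τ (.ofAdd b) v = ψ b • v := by
  cases nonempty_fintype B
  classical
  obtain ⟨u, hu⟩ := exists_ne (0 : V)
  -- the sum of the projections of `u` to the eigenspaces is a multiple of `u`
  have hsum : ∑ ψ : AddChar B ℂ, ∑ b : B, ψ (-b) • τ (.ofAdd b) u =
      (Fintype.card B : ℂ) • u := by
    rw [Finset.sum_comm]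
    simp only [← Finset.sum_smul, AddChar.sum_apply_eq_ite, neg_eq_zero]
    rw [Finset.sum_eq_single 0 (fun b _ hb ↦ by simp [hb]) (by simp)]
    simp
  obtain ⟨ψ, hψ⟩ : ∃ ψ : AddChar B ℂ, ∑ b : B, ψ (-b) • τ (.ofAdd b) u ≠ 0 := by
    by_contra! h0
    rw [Finset.sum_eq_zero fun ψ _ ↦ h0 ψ, eq_comm, smul_eq_zero] at hsum
    simp [hu] at hsum
  refine ⟨ψ, _, hψ, fun c ↦ ?_⟩
  rw [map_sum, Finset.smul_sum]
  refine Fintype.sum_equiv (Equiv.addLeft c) _ _ fun b ↦ ?_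
  rw [map_smul, smul_smul, Equiv.coe_addLeft, ofAdd_add, map_mul, Module.End.mul_apply,
    ← ψ.map_add_eq_mul, neg_add_rev, add_comm c, add_assoc, neg_add_cancel, add_zero]

/-- Every linear character of a finite abelian subgroup occurs in the restriction of an irreducible
representation: a quotient of the group algebra by a maximal left ideal containing all `b - ψ b`. -/
lemma exists_irreducible_eigenvector [Finite G] (i : Multiplicative B →* G)
    (hi : Function.Injective i) (ψ : AddChar B ℂ) :
    ∃ (n : ℕ) (ρ : Representation ℂ G (Fin n → ℂ)), ρ.IsIrreducible ∧
      ∃ v : Fin n → ℂ, v ≠ 0 ∧ ∀ b : B, ρ (i (.ofAdd b)) v = ψ b • v := by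
  cases nonempty_fintype B
  classical
  let R := MonoidAlgebra ℂ G
  let of : G →* R := MonoidAlgebra.of ℂ G
  let J : Ideal R := Ideal.span (Set.range fun b : B ↦ of (i (.ofAdd b)) - algebraMap ℂ R (ψ b))
  have hJ : J ≠ ⊤ := by
    -- the ideal annihilates the projection `e` to the eigenspace of `ψ`
    let e : R := ∑ b : B, algebraMap ℂ R (ψ (-b)) * of (i (.ofAdd b))
    have he : e ≠ 0 := by
      intro h0
      have h1 := congrArg (fun r : R ↦ r.coeff 1) h0
      have h2 (b : B) : (algebraMap ℂ R (ψ (-b)) * of (i (.ofAdd b))).coeff 1 =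
          if b = 0 then 1 else 0 := by
        have hb : i (.ofAdd b) = 1 ↔ b = 0 := by
          rw [← map_one i, hi.eq_iff, ofAdd_eq_one]
        by_cases h : b = 0
        · simp [R, of, h]
        · have := mt hb.1 h
          simp [R, of, this, h, MonoidAlgebra.of_apply]
      have h3 : e.coeff 1 = ∑ b : B, (algebraMap ℂ R (ψ (-b)) * of (i (.ofAdd b))).coeff 1 := by
        simp only [e, R, MonoidAlgebra.coeff_sum, Finsupp.finsetSum_apply]
      simp [h3, h2] at h1
    have hJe : ∀ r ∈ J, r * e = 0 := by
      intro r hr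
      induction hr using Submodule.span_induction with
      | mem r hr =>
        obtain ⟨c, rfl⟩ := hr
        rw [sub_mul, sub_eq_zero, Finset.mul_sum, Finset.mul_sum]
        refine Fintype.sum_equiv (Equiv.addLeft c) _ _ fun b ↦ ?_
        rw [Equiv.coe_addLeft, ofAdd_add, map_mul i, map_mul of, ← mul_assoc, ← mul_assoc,
          ← map_mul (algebraMap ℂ R), ← ψ.map_add_eq_mul, neg_add_rev, add_comm c, add_assoc,
          neg_add_cancel, add_zero, ← Algebra.commutes, mul_assoc]
      | zero => simp
      | add r s _ _ hr hs => rw [add_mul, hr, hs, add_zero]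
      | smul t r _ hr => rw [smul_eq_mul, mul_assoc, hr, mul_zero]
    intro htop
    exact he (by simpa using hJe 1 (htop ▸ Submodule.mem_top))
  obtain ⟨m, hm, hJm⟩ := Ideal.exists_le_maximal J hJ
  let V := R ⧸ m
  have hfin : FiniteDimensional ℂ R := by
    unfold R
    infer_instance
  have hfinV : FiniteDimensional ℂ V :=
    Module.Finite.of_surjective (m.mkQ.restrictScalars ℂ) (Submodule.mkQ_surjective m)
  let f : V ≃ₗ[ℂ] (Fin (Module.finrank ℂ V) → ℂ) := (Module.finBasis ℂ V).equivFun
  let ρ : Representation ℂ G (Fin (Module.finrank ℂ V) → ℂ) :=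
    ((f.conjAlgEquiv ℂ).toAlgHom.comp (Algebra.lsmul ℂ ℂ V)).toMonoidHom.comp of
  have hρ (g : G) (v : V) : ρ g (f v) = f (of g • v) := by
    simp [ρ]
  have hsimple : IsSimpleModule R V := isSimpleModule_iff_isCoatom.2 hm.out
  refine ⟨_, ρ, ?_, f (Submodule.Quotient.mk 1), ?_, ?_⟩
  · have hinv (W : Subrepresentation ρ) : ∃ U : Submodule R V, ∀ v, v ∈ U ↔ f v ∈ W := by
      refine ⟨{ W.toSubmodule.comap f.toLinearMap with
        smul_mem' := fun r v hv ↦ ?_ }, fun v ↦ Iff.rfl⟩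
      change f (r • v) ∈ W
      induction r using MonoidAlgebra.induction_linear with
      | zero => rw [zero_smul, map_zero]; exact W.toSubmodule.zero_mem
      | add r s hr hs => rw [add_smul, map_add]; exact W.toSubmodule.add_mem hr hs
      | single g c =>
        have h1 : (MonoidAlgebra.single g c : R) = c • of g := by simp [R, of]
        rw [h1, smul_assoc, map_smul, ← hρ]
        exact W.toSubmodule.smul_mem _ (W.apply_mem_toSubmodule g hv)
    have hnontriv : Nontrivial (Subrepresentation ρ) := by
      refine ⟨⊥, ⊤, fun h ↦ ?_⟩
      have := IsSimpleModule.nontrivial R V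
      obtain ⟨v, hv⟩ := exists_ne (0 : V)
      have h1 : f v ∈ (⊤ : Subrepresentation ρ) := (Submodule.mem_top : f v ∈ (⊤ : Submodule ℂ _))
      rw [← h] at h1
      have h2 : f v = 0 := h1
      exact hv (by simpa using h2)
    refine { eq_bot_or_eq_top := fun W ↦ ?_ }
    obtain ⟨U, hU⟩ := hinv W
    refine (eq_bot_or_eq_top U).imp (fun h ↦ ?_) (fun h ↦ ?_)
    · refine SetLike.ext fun w ↦ ?_
      obtain ⟨v, rfl⟩ := f.surjective w
      rw [← hU, h, Submodule.mem_bot]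
      change _ ↔ f v = 0
      simp
    · refine SetLike.ext fun w ↦ ?_
      obtain ⟨v, rfl⟩ := f.surjective w
      rw [← hU, h]
      exact iff_of_true Submodule.mem_top (Submodule.mem_top : f v ∈ (⊤ : Submodule ℂ _))
  · rw [ne_eq, LinearEquiv.map_eq_zero_iff, Submodule.Quotient.mk_eq_zero, ← Ideal.eq_top_iff_one]
    exact hm.ne_top
  · intro b
    rw [hρ, ← map_smul]
    congr 1
    rw [← sub_eq_zero, ← algebraMap_smul R (ψ b), ← sub_smul, ← Submodule.Quotient.mk_smul,
      Submodule.Quotient.mk_eq_zero, smul_eq_mul, mul_one]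
    exact hJm (Ideal.subset_span ⟨b, rfl⟩)

end Weights

/-! ### The action on an abelian normal subgroup by conjugation -/

open scoped IsMulCommutative

universe u

section ConjAction

variable {G : Type u} [Group G]

/-- The conjugation action `a ↦ a ^ g = g⁻¹ a g` on an abelian normal subgroup, written
additively. -/
def conjEnd (A : Subgroup G) [A.Normal] [IsMulCommutative A] (g : G) :
    Module.End ℤ (Additive A) :=
  (MulAut.conjNormal g⁻¹ : A ≃* A).toMonoidHom.toAdditive.toIntLinearMap

/-- An element of the additive version of the subgroup `A`, as an element of the group. -/
def addVal {A : Subgroup G} (m : Additive A) : G :=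
  (m.toMul : A)

section addVal

variable {A : Subgroup G}

lemma addVal_mem (m : Additive A) : addVal m ∈ A := (m.toMul : A).2

lemma addVal_injective : Function.Injective (addVal : Additive A → G) :=
  fun _ _ h ↦ Additive.toMul.injective (Subtype.ext h)

lemma exists_addVal_eq {g : G} (hg : g ∈ A) : ∃ m : Additive A, addVal m = g :=
  ⟨.ofMul ⟨g, hg⟩, rfl⟩

@[simp] lemma addVal_add (m m' : Additive A) : addVal (m + m') = addVal m * addVal m' := rfl

@[simp] lemma addVal_zero : addVal (0 : Additive A) = 1 := rfl

@[simp] lemma addVal_neg (m : Additive A) : addVal (-m) = (addVal m)⁻¹ := rfl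

@[simp] lemma addVal_sub (m m' : Additive A) : addVal (m - m') = addVal m / addVal m' := rfl

@[simp] lemma addVal_nsmul (n : ℕ) (m : Additive A) : addVal (n • m) = addVal m ^ n := rfl

@[simp] lemma addVal_zsmul (n : ℤ) (m : Additive A) : addVal (n • m) = addVal m ^ n := rfl

variable [IsMulCommutative A]

lemma addVal_conjEnd [A.Normal] (g : G) (m : Additive A) :
    addVal (conjEnd A g m) = conjBy (addVal m) g := by
  change ((MulAut.conjNormal g⁻¹ (m.toMul) : A) : G) = _
  rw [MulAut.conjNormal_apply, inv_inv]
  rfl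

lemma addVal_mul_comm (m m' : Additive A) : addVal m * addVal m' = addVal m' * addVal m := by
  rw [← addVal_add, add_comm, addVal_add]

end addVal

/-- The group is generated by its abelian normal subgroup `A` and the elements `x` and `y`, and `A`
is a faithful module for a commutative ring in which `X` and `Y` act by conjugation with `x`
and `y`, as a primitive cube root of unity and an involution. -/
structure IsConjAction {S : Type*} [CommRing S] (A : Subgroup G) [IsMulCommutative A]
    [Module S (Additive A)] (x y : G) (X Y : S) : Prop where
  eis : EisensteinInvolution X Y
  smul_x : ∀ m : Additive A, addVal (X • m) = conjBy (addVal m) x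
  smul_y : ∀ m : Additive A, addVal (Y • m) = conjBy (addVal m) y
  faithful : ∀ s : S, (∀ m : Additive A, s • m = 0) → s = 0
  sup_eq_top : A ⊔ Subgroup.zpowers x ⊔ Subgroup.zpowers y = ⊤

lemma EisensteinInvolution.smul_mem {S M : Type*} [CommRing S] [AddCommGroup M] [Module S M]
    {x y : S} (h : EisensteinInvolution x y) (K : AddSubgroup M) (hx : ∀ m ∈ K, x • m ∈ K)
    (hy : ∀ m ∈ K, y • m ∈ K) (s : S) {m : M} (hm : m ∈ K) : s • m ∈ K := by
  obtain ⟨i, j, k, l, rfl⟩ := h.gen s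
  have e : ((i : S) + j * x + (k + l * x) * y) • m =
      i • m + j • (x • m) + (k • (y • m) + l • (x • y • m)) := by
    simp only [← Int.cast_smul_eq_zsmul S]
    module
  rw [e]
  exact K.add_mem (K.add_mem (K.zsmul_mem hm _) (K.zsmul_mem (hx _ hm) _))
    (K.add_mem (K.zsmul_mem (hy _ hm) _) (K.zsmul_mem (hx _ (hy _ hm)) _))

variable {A : Subgroup G} [IsMulCommutative A]

theorem exists_isConjAction [A.Normal] [Finite G] (hA : IsPGroup 2 A) {x y : G}
    (hxy : Commute x y) (hx : ∀ a ∈ A, a * conjBy a x * conjBy a (x ^ 2) = 1) (hy : y ^ 2 = 1)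
    (htop : A ⊔ Subgroup.zpowers x ⊔ Subgroup.zpowers y = ⊤) :
    ∃ (S : Type u) (_ : CommRing S) (_ : Module S (Additive A)) (X Y : S),
      IsConjAction A x y X Y := by
  set X := conjEnd A x with hX
  set Y := conjEnd A y with hY
  have hXY : X * Y = Y * X := by
    refine LinearMap.ext fun m ↦ addVal_injective ?_
    simp only [hX, hY, Module.End.mul_apply, addVal_conjEnd, conjBy]
    have h1 := hxy.eq
    have h2 := hxy.inv_inv.eq
    simp only [mul_assoc, h1]
    simp only [← mul_assoc, h2]
  have hX2 : X ^ 2 + X + 1 = 0 := by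
    refine LinearMap.ext fun m ↦ addVal_injective ?_
    have h1 : addVal ((X ^ 2 + X + 1 : Module.End ℤ (Additive A)) m) =
        conjBy (conjBy (addVal m) x) x * conjBy (addVal m) x * addVal m := by
      rw [← addVal_conjEnd (A := A), ← addVal_conjEnd (A := A)]
      rfl
    have h2 := hx _ (addVal_mem m)
    have h3 : conjBy (addVal m) (x ^ 2) = conjBy (conjBy (addVal m) x) x := by
      simp only [conjBy, pow_two]
      group
    rw [h3, ← addVal_conjEnd (A := A), ← addVal_conjEnd (A := A), ← addVal_add, ← addVal_add] at h2
    rw [h1, ← addVal_conjEnd (A := A), ← addVal_conjEnd (A := A), ← addVal_add, ← addVal_add,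
      LinearMap.zero_apply, addVal_zero, ← h2]
    congr 1
    abel
  have hY2 : Y ^ 2 = 1 := by
    refine LinearMap.ext fun m ↦ addVal_injective ?_
    have h1 : addVal ((Y ^ 2 : Module.End ℤ (Additive A)) m) = conjBy (conjBy (addVal m) y) y := by
      rw [← addVal_conjEnd (A := A), ← addVal_conjEnd (A := A)]
      rfl
    rw [h1]
    calc _ = (y ^ 2)⁻¹ * addVal m * y ^ 2 := by simp only [conjBy, pow_two]; group
      _ = _ := by rw [hy]; simp
  have hcomm : ∀ a ∈ ({X, Y} : Set (Module.End ℤ (Additive A))),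
      ∀ b ∈ ({X, Y} : Set (Module.End ℤ (Additive A))), a * b = b * a := by
    rintro _ (rfl | rfl) _ (rfl | rfl) <;> simp [hXY]
  have := Algebra.isMulCommutative_adjoin ℤ hcomm
  let S := Algebra.adjoin ℤ ({X, Y} : Set (Module.End ℤ (Additive A)))
  let X' : S := ⟨X, Algebra.subset_adjoin (by simp)⟩
  let Y' : S := ⟨Y, Algebra.subset_adjoin (by simp)⟩
  have hX' : X' ^ 2 + X' + 1 = 0 := Subtype.ext hX2
  have hY' : Y' ^ 2 = 1 := Subtype.ext hY2
  have hgen (s : Module.End ℤ (Additive A)) (hs : s ∈ S) :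
      ∃ i j k l : ℤ, (⟨s, hs⟩ : S) = i + j * X' + (k + l * X') * Y' := by
    induction hs using Algebra.adjoin_induction with
    | mem s hs =>
      rcases hs with rfl | rfl
      · exact ⟨0, 1, 0, 0, by simp [X']⟩
      · exact ⟨0, 0, 1, 0, by simp [Y']⟩
    | algebraMap n => exact ⟨n, 0, 0, 0, by simp; rfl⟩
    | add s t hs ht ihs iht =>
      obtain ⟨i, j, k, l, h⟩ := ihs
      obtain ⟨i', j', k', l', h'⟩ := iht
      refine ⟨i + i', j + j', k + k', l + l', ?_⟩
      have : (⟨s + t, add_mem hs ht⟩ : S) = ⟨s, hs⟩ + ⟨t, ht⟩ := rfl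
      rw [this, h, h']
      push_cast
      ring
    | mul s t hs ht ihs iht =>
      obtain ⟨i, j, k, l, h⟩ := ihs
      obtain ⟨i', j', k', l', h'⟩ := iht
      refine ⟨i * i' - j * j' + k * k' - l * l',
        i * j' + j * i' - j * j' + k * l' + l * k' - l * l',
        i * k' - j * l' + k * i' - l * j', i * l' + j * k' - j * l' + k * j' + l * i' - l * j', ?_⟩
      have : (⟨s * t, mul_mem hs ht⟩ : S) = ⟨s, hs⟩ * ⟨t, ht⟩ := rfl
      rw [this, h, h']
      push_cast
      linear_combination (j * j' + l * l' + (j * l' + l * j') * Y' : S) * hX' +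
        ((k + l * X') * (k' + l' * X') : S) * hY'
  have hnil : ∃ N : ℕ, (2 : S) ^ N = 0 := by
    obtain ⟨N, hN⟩ := (IsPGroup.iff_card (p := 2)).1 hA
    refine ⟨N, Subtype.ext (LinearMap.ext fun m ↦ ?_)⟩
    have h1 : ((2 : S) ^ N : S) • m = (2 ^ N : ℕ) • m := by
      rw [← Nat.cast_smul_eq_nsmul S]
      push_cast
      rfl
    refine h1.trans ?_
    rw [← hN]
    exact card_nsmul_eq_zero'
  refine ⟨S, inferInstance, inferInstance, X', Y', ⟨hX', hY', hnil, fun s ↦ hgen s.1 s.2⟩,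
    addVal_conjEnd x, addVal_conjEnd y, fun s hs ↦ Subtype.ext (LinearMap.ext hs), htop⟩

end ConjAction

/-! ### Nonvanishing elements, orbit sums and the nilpotency class -/

section OrbitSum

variable {G : Type u} [Group G] {A : Subgroup G} [IsMulCommutative A]
  {S : Type*} [CommRing S] [Module S (Additive A)] {x y : G} {X Y : S}

namespace IsConjAction

/-- To check that a subgroup is everything, it suffices to look at `A`, `x` and `y`. -/
lemma mem_of_generators (h : IsConjAction A x y X Y) {K : Subgroup G} (hA : A ≤ K) (hx : x ∈ K)
    (hy : y ∈ K) (g : G) : g ∈ K := by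
  have : (⊤ : Subgroup G) ≤ K := by
    rw [← h.sup_eq_top]
    simp [hA, hx, hy]
  exact this (Subgroup.mem_top g)

/-- Conjugation permutes the orbit of an element of `A` under `X` and `Y`. -/
lemma exists_perm [A.Normal] (h : IsConjAction A x y X Y) (m : Additive A) (g : G) :
    ∃ π : Equiv.Perm (Fin 3 × Fin 2), ∀ i : Fin 3 × Fin 2,
      g * addVal ((X ^ (i.1 : ℕ) * Y ^ (i.2 : ℕ)) • m) * g⁻¹ =
        addVal ((X ^ ((π i).1 : ℕ) * Y ^ ((π i).2 : ℕ)) • m) := by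
  set a : Fin 3 × Fin 2 → G := fun i ↦ addVal ((X ^ (i.1 : ℕ) * Y ^ (i.2 : ℕ)) • m) with ha
  let K : Subgroup G :=
    { carrier := {g | ∃ π : Equiv.Perm (Fin 3 × Fin 2), ∀ i, g * a i * g⁻¹ = a (π i)}
      one_mem' := ⟨1, fun i ↦ by simp⟩
      mul_mem' := by
        rintro g g' ⟨π, hπ⟩ ⟨π', hπ'⟩
        refine ⟨π * π', fun i ↦ ?_⟩
        rw [Equiv.Perm.mul_apply, ← hπ, ← hπ']
        group
      inv_mem' := by
        rintro g ⟨π, hπ⟩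
        refine ⟨π.symm, fun i ↦ ?_⟩
        have := hπ (π.symm i)
        rw [Equiv.apply_symm_apply] at this
        rw [← this]
        group }
  refine h.mem_of_generators (K := K) (fun b hb ↦ ⟨1, fun i ↦ ?_⟩) ?_ ?_ g
  · obtain ⟨m', rfl⟩ := exists_addVal_eq hb
    rw [addVal_mul_comm, mul_inv_cancel_right]
    rfl
  · refine K.inv_mem_iff.1 ⟨Equiv.prodCongr (Equiv.addRight 1) (Equiv.refl _), fun ⟨i, j⟩ ↦ ?_⟩
    have h1 : x⁻¹ * a (i, j) * x⁻¹⁻¹ = addVal ((X ^ ((i : ℕ) + 1) * Y ^ (j : ℕ)) • m) := by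
      rw [inv_inv, pow_succ', mul_assoc X, mul_smul X, h.smul_x]
      rfl
    rw [h1]
    simp only [ha, Equiv.prodCongr_apply, Prod.map, Equiv.coe_addRight, Equiv.refl_apply]
    fin_cases i
    · rfl
    · rfl
    · simp [h.eis.cube]
  · refine K.inv_mem_iff.1 ⟨Equiv.prodCongr (Equiv.refl _) (Equiv.addRight 1), fun ⟨i, j⟩ ↦ ?_⟩
    have h1 : y⁻¹ * a (i, j) * y⁻¹⁻¹ = addVal ((X ^ (i : ℕ) * Y ^ ((j : ℕ) + 1)) • m) := by
      rw [inv_inv, pow_succ', mul_left_comm, mul_smul Y, h.smul_y]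
      rfl
    rw [h1]
    simp only [ha, Equiv.prodCongr_apply, Prod.map, Equiv.coe_addRight, Equiv.refl_apply]
    fin_cases j
    · rfl
    · simp [h.eis.sq_eq]

/-- The orbit sum of a linear constituent of an irreducible character `χ` determines the values of
`χ`: up to the factor `χ 1 / 6`, it is the value of `χ`. -/
lemma character_mul_eq (h : IsConjAction A x y X Y) [A.Normal] {n : ℕ}
    {ρ : Representation ℂ G (Fin n → ℂ)} (hρ : ρ.IsIrreducible) {v : Fin n → ℂ} (hv : v ≠ 0)
    {ψ : AddChar (Additive A) ℂ} (hψ : ∀ m : Additive A, ρ (addVal m) v = ψ m • v)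
    (m : Additive A) : 6 * ρ.character (addVal m) = n * orbitSum X Y ψ m := by
  have h1 := sum_character_eq hρ
    (fun i : Fin 3 × Fin 2 ↦ addVal ((X ^ (i.1 : ℕ) * Y ^ (i.2 : ℕ)) • m))
    (h.exists_perm m) hv (fun i ↦ hψ _)
  have hconj (g : G) (m : Additive A) : ρ.character (conjBy (addVal m) g) =
      ρ.character (addVal m) := by
    have := ρ.char_conj (addVal m) g⁻¹
    rwa [inv_inv] at this
  have hX (m : Additive A) : ρ.character (addVal (X • m)) = ρ.character (addVal m) := by
    rw [h.smul_x, hconj]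
  have hY (m : Additive A) : ρ.character (addVal (Y • m)) = ρ.character (addVal m) := by
    rw [h.smul_y, hconj]
  simp only [Fintype.sum_prod_type, Fin.sum_univ_three, Fin.sum_univ_two, Fin.val_zero,
    Fin.val_one, Fin.val_two, pow_zero, pow_one, one_smul, mul_smul, pow_two,
    hX, hY] at h1
  rw [orbitSum]
  simp only [mul_smul, pow_two]
  linear_combination h1

/-- An irreducible character vanishes at an element of `A` if and only if the orbit sum of one of
its linear constituents does, and each linear character of `A` is such a constituent. -/
theorem subset_nonvanishingSet_iff [Finite G] [A.Normal] (h : IsConjAction A x y X Y) :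
    (A : Set G) ⊆ nonvanishingSet G ↔
      ∀ (ψ : AddChar (Additive A) ℂ) (m : Additive A), orbitSum X Y ψ m ≠ 0 := by
  let i : Multiplicative (Additive A) →* G :=
    { toFun := fun m ↦ addVal m.toAdd
      map_one' := rfl
      map_mul' := fun _ _ ↦ rfl }
  constructor
  · intro hA ψ m h0
    obtain ⟨n, ρ, hρ, v, hv, hψ⟩ := exists_irreducible_eigenvector i
      (fun _ _ h ↦ addVal_injective h) ψ
    have h1 := h.character_mul_eq hρ hv hψ m
    rw [h0, mul_zero] at h1
    refine hA (addVal_mem m) ⟨ρ.character, ⟨n, ρ, hρ, rfl⟩, ?_⟩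
    exact (mul_eq_zero.1 h1).resolve_left (by norm_num)
  · rintro hsum a ha ⟨χ, ⟨n, ρ, hρ, rfl⟩, h0⟩
    obtain ⟨m, rfl⟩ := exists_addVal_eq ha
    have hn : n ≠ 0 := by
      rintro rfl
      have : Subsingleton (Subrepresentation ρ) :=
        Subrepresentation.toSubmodule_injective.subsingleton
      exact not_subsingleton _ this
    have : Nontrivial (Fin n → ℂ) := by
      have : Nonempty (Fin n) := ⟨⟨0, by omega⟩⟩
      infer_instance
    obtain ⟨ψ, v, hv, hψ⟩ := exists_common_eigenvector (B := Additive A) (V := Fin n → ℂ)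
      (ρ.comp i)
    have h1 := h.character_mul_eq hρ hv hψ m
    rw [h0, mul_zero, eq_comm, mul_eq_zero] at h1
    exact hsum ψ m (h1.resolve_left (by exact_mod_cast hn))

/-- If `2 (Y - 1)` kills `A` then `[A, y, y] = 1`, so that the commutator subgroup of `A⟨y⟩` is
central. -/
lemma nilpotencyClass_le_two [A.Normal] (h : IsConjAction A x y X Y) (hy : y ^ 2 = 1)
    (h0 : ∀ m : Additive A, (2 * (Y - 1)) • m = 0) :
    Group.nilpotencyClass (A ⊔ Subgroup.zpowers y : Subgroup G) ≤ 2 := by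
  set Q := A ⊔ Subgroup.zpowers y with hQ
  have hyy : y⁻¹ = y := inv_eq_of_mul_eq_one_left (by rw [← pow_two, hy])
  have hYy (m : Additive A) : y * addVal m = addVal (Y • m) * y := by
    rw [h.smul_y, conjBy, hyy, mul_assoc, mul_assoc, ← pow_two, hy, mul_one]
  have hform (q : G) (hq : q ∈ Q) : ∃ m : Additive A, q = addVal m ∨ q = addVal m * y := by
    have hq' : q ∈ (Q : Set G) := hq
    rw [hQ, Subgroup.normal_mul] at hq'
    obtain ⟨a, ha, z, ⟨k, rfl⟩, rfl⟩ := hq'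
    obtain ⟨m, rfl⟩ := exists_addVal_eq ha
    refine ⟨m, ?_⟩
    have hy2 : y ^ (2 : ℤ) = 1 := by exact_mod_cast hy
    rcases Int.even_or_odd' k with ⟨l, rfl | rfl⟩
    · left
      simp [zpow_mul, hy2]
    · right
      simp [zpow_add, zpow_mul, hy2]
  -- every commutator is an element of `A` fixed by `y`
  have hcomm (q q' : G) (hq : q ∈ Q) (hq' : q' ∈ Q) :
      ∃ d : Additive A, Y • d = d ∧ q * q' = addVal d * (q' * q) := by
    have hfix (m : Additive A) : Y • (m - Y • m) = m - Y • m := by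
      have hYY : (Y ^ 2) • m = m := by rw [h.eis.sq_eq, one_smul]
      linear_combination (norm := module) h0 m - hYY
    obtain ⟨m, rfl | rfl⟩ := hform q hq <;> obtain ⟨m', rfl | rfl⟩ := hform q' hq'
    · refine ⟨0, by simp, ?_⟩
      rw [addVal_mul_comm]
      simp
    · refine ⟨m - Y • m, hfix m, ?_⟩
      rw [mul_assoc (addVal m') y, hYy]
      simp only [← mul_assoc, ← addVal_add]
      congr 2
      abel
    · refine ⟨-(m' - Y • m'), by rw [smul_neg, hfix], ?_⟩
      rw [mul_assoc (addVal m) y, hYy]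
      simp only [← mul_assoc, ← addVal_add]
      congr 2
      abel
    · refine ⟨(m - m') - Y • (m - m'), hfix _, ?_⟩
      have e (m m' : Additive A) : addVal m * y * (addVal m' * y) =
          addVal (m + Y • m') * (y * y) := by
        rw [mul_assoc, ← mul_assoc y, hYy, addVal_add]
        group
      rw [e, e, ← mul_assoc (addVal _) (addVal _) (y * y), ← addVal_add]
      congr 2
      module
  have hcenter (d : Additive A) (hd : Y • d = d) (q : G) (hq : q ∈ Q) :
      addVal d * q = q * addVal d := by
    obtain ⟨m, rfl | rfl⟩ := hform q hq
    · exact addVal_mul_comm d m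
    · rw [mul_assoc, hYy, hd, ← mul_assoc, ← mul_assoc, addVal_mul_comm d m]
  have htop : Subgroup.upperCentralSeries Q 2 = ⊤ := by
    refine eq_top_iff.2 fun q _ ↦ ?_
    refine Subgroup.mem_upperCentralSeries_succ_iff.2 fun q' ↦ ?_
    rw [Subgroup.upperCentralSeries_one, Subgroup.mem_center_iff]
    intro r
    obtain ⟨d, hd, hqq⟩ := hcomm q q' q.2 q'.2
    have h1 : (q * q' * (q : G)⁻¹ * (q' : G)⁻¹ : G) = addVal d := by
      rw [hqq]
      group
    refine Subtype.ext ?_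
    rw [commutatorElement_def]
    push_cast
    rw [h1]
    exact (hcenter d hd r r.2).symm
  have : Group.IsNilpotent Q := ⟨2, htop⟩
  exact Subgroup.upperCentralSeries_eq_top_iff_nilpotencyClass_le.1 htop

end IsConjAction

end OrbitSum

/-! ### Submodules and normal subgroups -/

section Dictionary

variable {G : Type u} [Group G] {A : Subgroup G}

/-- The subgroup of `G` that corresponds to a subgroup of the additive version of `A`. -/
def ofAddSubgroup (K : AddSubgroup (Additive A)) : Subgroup G :=
  (AddSubgroup.toSubgroup' K).map A.subtype

@[simp] lemma addVal_mem_ofAddSubgroup {K : AddSubgroup (Additive A)} {m : Additive A} :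
    addVal m ∈ ofAddSubgroup K ↔ m ∈ K :=
  ⟨fun ⟨_, hm', h⟩ ↦ addVal_injective h ▸ hm', fun h ↦ ⟨m, h, rfl⟩⟩

lemma ofAddSubgroup_le_iff {K : AddSubgroup (Additive A)} {L : Subgroup G} :
    ofAddSubgroup K ≤ L ↔ ∀ m ∈ K, addVal m ∈ L :=
  ⟨fun h _ hm ↦ h ⟨_, hm, rfl⟩, by rintro h _ ⟨m, hm, rfl⟩; exact h m hm⟩

lemma ofAddSubgroup_mono {K L : AddSubgroup (Additive A)} (h : K ≤ L) :
    ofAddSubgroup K ≤ ofAddSubgroup L :=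
  ofAddSubgroup_le_iff.2 fun _ hm ↦ addVal_mem_ofAddSubgroup.2 (h hm)

lemma ofAddSubgroup_bot : ofAddSubgroup (⊥ : AddSubgroup (Additive A)) = ⊥ := by
  simp [ofAddSubgroup]

lemma ofAddSubgroup_closure (s : Set (Additive A)) :
    ofAddSubgroup (AddSubgroup.closure s) = Subgroup.closure (addVal '' s) := by
  rw [ofAddSubgroup, AddSubgroup.toSubgroup'_closure, MonoidHom.map_closure]
  rfl

/-- The elements of `K`, written multiplicatively, form a group isomorphic to the corresponding
subgroup of `G`. -/
noncomputable def ofAddSubgroupEquiv (K : AddSubgroup (Additive A)) :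
    Multiplicative K ≃* ofAddSubgroup K :=
  MulEquiv.ofBijective
    (MonoidHom.mk'
      (fun m : Multiplicative K ↦
        (⟨addVal (m.toAdd : Additive A), addVal_mem_ofAddSubgroup.2 m.toAdd.2⟩ : ofAddSubgroup K))
      fun _ _ ↦ rfl)
    ⟨fun _ _ h ↦ Multiplicative.toAdd.injective
        (Subtype.ext (addVal_injective (Subtype.mk_eq_mk.1 h))),
      fun ⟨_, m, hm, h⟩ ↦ ⟨.ofAdd ⟨m, hm⟩, Subtype.ext h⟩⟩

@[simp] lemma coe_ofAddSubgroupEquiv (K : AddSubgroup (Additive A)) (m : Multiplicative K) :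
    (ofAddSubgroupEquiv K m : G) = addVal (m.toAdd : Additive A) := rfl

lemma exponent_ofAddSubgroup_dvd_iff {K : AddSubgroup (Additive A)} {n : ℕ} :
    Monoid.exponent (ofAddSubgroup K) ∣ n ↔ ∀ m ∈ K, addVal m ^ n = 1 := by
  rw [Monoid.exponent_dvd_iff_forall_pow_eq_one]
  constructor
  · intro h m hm
    exact congrArg Subtype.val (h ⟨_, addVal_mem_ofAddSubgroup.2 hm⟩)
  · rintro h ⟨_, m, hm, rfl⟩
    exact Subtype.ext (h m hm)

variable [IsMulCommutative A] {S : Type*} [CommRing S] [Module S (Additive A)] {x y : G} {X Y : S}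

/-- The subgroup of `G` that corresponds to a submodule of `A`. -/
def ofSubmodule (N : Submodule S (Additive A)) : Subgroup G :=
  ofAddSubgroup N.toAddSubgroup

lemma mem_ofSubmodule {N : Submodule S (Additive A)} {g : G} :
    g ∈ ofSubmodule N ↔ ∃ m ∈ N, addVal m = g := Iff.rfl

@[simp] lemma addVal_mem_ofSubmodule {N : Submodule S (Additive A)} {m : Additive A} :
    addVal m ∈ ofSubmodule N ↔ m ∈ N := addVal_mem_ofAddSubgroup

/-- The elements of `N`, written multiplicatively, form a group isomorphic to the corresponding
subgroup of `G`. -/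
noncomputable def ofSubmoduleEquiv (N : Submodule S (Additive A)) :
    Multiplicative N ≃* ofSubmodule N :=
  ofAddSubgroupEquiv N.toAddSubgroup

lemma coe_ofSubmoduleEquiv (N : Submodule S (Additive A)) (m : Multiplicative N) :
    (ofSubmoduleEquiv N m : G) = addVal (m.toAdd : Additive A) := rfl

lemma ofSubmodule_le_iff {N : Submodule S (Additive A)} {L : Subgroup G} :
    ofSubmodule N ≤ L ↔ ∀ m ∈ N, addVal m ∈ L := ofAddSubgroup_le_iff

lemma ofSubmodule_mono {N N' : Submodule S (Additive A)} (h : N ≤ N') :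
    ofSubmodule N ≤ ofSubmodule N' := ofAddSubgroup_mono h

lemma ofSubmodule_top : ofSubmodule (⊤ : Submodule S (Additive A)) = A :=
  le_antisymm (ofSubmodule_le_iff.2 fun m _ ↦ addVal_mem m)
    fun _ hg ↦ by
      obtain ⟨m, rfl⟩ := exists_addVal_eq hg
      exact addVal_mem_ofSubmodule.2 Submodule.mem_top

lemma ofSubmodule_bot : ofSubmodule (⊥ : Submodule S (Additive A)) = ⊥ :=
  ofAddSubgroup_bot

lemma ofSubmodule_inf (N N' : Submodule S (Additive A)) :
    ofSubmodule (N ⊓ N') = ofSubmodule N ⊓ ofSubmodule N' := by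
  refine le_antisymm (le_inf (ofSubmodule_mono inf_le_left) (ofSubmodule_mono inf_le_right)) ?_
  rintro _ ⟨⟨m, hm, rfl⟩, h⟩
  exact addVal_mem_ofSubmodule.2 ⟨hm, addVal_mem_ofSubmodule.1 h⟩

lemma ofSubmodule_iSup {ι : Sort*} (N : ι → Submodule S (Additive A)) :
    ofSubmodule (⨆ i, N i) = ⨆ i, ofSubmodule (N i) := by
  refine le_antisymm (ofSubmodule_le_iff.2 fun m hm ↦ ?_)
    (iSup_le fun i ↦ ofSubmodule_mono (le_iSup N i))
  induction hm using Submodule.iSup_induction' with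
  | mem i m hm => exact Subgroup.mem_iSup_of_mem i (addVal_mem_ofSubmodule.2 hm)
  | zero => exact one_mem _
  | add m m' _ _ h h' => exact mul_mem h h'

lemma ofSubmodule_sup (N N' : Submodule S (Additive A)) :
    ofSubmodule (N ⊔ N') = ofSubmodule N ⊔ ofSubmodule N' := by
  rw [sup_eq_iSup, ofSubmodule_iSup, sup_eq_iSup]
  congr 1
  funext b
  cases b <;> rfl

lemma iSupIndep_ofSubmodule {ι : Type*} {N : ι → Submodule S (Additive A)} (h : iSupIndep N) :
    iSupIndep fun i ↦ ofSubmodule (N i) := by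
  intro i
  have := h i
  rw [disjoint_iff] at this ⊢
  simp only [← ofSubmodule_iSup, ← ofSubmodule_inf, this, ofSubmodule_bot]

namespace IsConjAction

/-- Conjugation by any element of the group acts on `A` as an element of the ring. -/
lemma exists_smul_eq_conjBy (h : IsConjAction A x y X Y) (g : G) :
    ∃ s : S, ∀ m : Additive A, addVal (s • m) = conjBy (addVal m) g := by
  let K : Subgroup G :=
    { carrier := {g | ∃ s : Sˣ, ∀ m : Additive A, addVal ((s : S) • m) = conjBy (addVal m) g}
      one_mem' := ⟨1, fun m ↦ by simp [conjBy]⟩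
      mul_mem' := by
        rintro g g' ⟨s, hs⟩ ⟨s', hs'⟩
        refine ⟨s' * s, fun m ↦ ?_⟩
        rw [Units.val_mul, mul_smul, hs', hs]
        simp only [conjBy]
        group
      inv_mem' := by
        rintro g ⟨s, hs⟩
        refine ⟨s⁻¹, fun m ↦ ?_⟩
        have := hs ((s⁻¹ : Sˣ) • m)
        rw [Units.smul_def, smul_smul, s.mul_inv, one_smul] at this
        rw [this]
        simp only [conjBy]
        group }
  have hA : A ≤ K := fun b hb ↦ ⟨1, fun m ↦ by
    obtain ⟨m', rfl⟩ := exists_addVal_eq hb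
    simp [conjBy, mul_assoc, addVal_mul_comm m m']⟩
  obtain ⟨s, hs⟩ := h.mem_of_generators hA
    ⟨Units.ofPowEqOne X 3 h.eis.cube (by decide), h.smul_x⟩
    ⟨Units.ofPowEqOne Y 2 h.eis.sq_eq (by decide), h.smul_y⟩ g
  exact ⟨s, hs⟩

lemma normal_ofSubmodule (h : IsConjAction A x y X Y) (N : Submodule S (Additive A)) :
    (ofSubmodule N).Normal := by
  refine ⟨?_⟩
  intro _ ha g
  obtain ⟨m, hm, rfl⟩ := mem_ofSubmodule.1 ha
  obtain ⟨s, hs⟩ := h.exists_smul_eq_conjBy g⁻¹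
  have : g * addVal m * g⁻¹ = addVal (s • m) := by rw [hs, conjBy, inv_inv]
  exact this ▸ addVal_mem_ofSubmodule.2 (N.smul_mem s hm)

/-- The submodule of `A` that corresponds to the intersection of `A` with a normal subgroup. -/
def submoduleOfNormal (h : IsConjAction A x y X Y) (L : Subgroup G) [hL : L.Normal] :
    Submodule S (Additive A) where
  __ := (L.subgroupOf A).toAddSubgroup
  smul_mem' s m hm :=
    h.eis.smul_mem (L.subgroupOf A).toAddSubgroup
      (fun m (hm : addVal m ∈ L) ↦ by
        change addVal (X • m) ∈ L
        rw [h.smul_x]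
        exact hL.conj_mem' _ hm x)
      (fun m (hm : addVal m ∈ L) ↦ by
        change addVal (Y • m) ∈ L
        rw [h.smul_y]
        exact hL.conj_mem' _ hm y) s hm

lemma ofSubmodule_span_singleton (h : IsConjAction A x y X Y) (m : Additive A) :
    ofSubmodule (Submodule.span S {m}) = Subgroup.normalClosure {addVal m} := by
  apply le_antisymm
  · have : Submodule.span S {m} ≤ h.submoduleOfNormal (Subgroup.normalClosure {addVal m}) := by
      rw [Submodule.span_singleton_le_iff_mem]
      exact Subgroup.subset_normalClosure (Set.mem_singleton (addVal m))
    exact ofSubmodule_le_iff.2 fun m hm ↦ this hm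
  · have := h.normal_ofSubmodule (Submodule.span S {m})
    refine Subgroup.normalClosure_le_normal ?_
    rintro _ rfl
    exact addVal_mem_ofSubmodule.2 (Submodule.mem_span_singleton_self m)

lemma moduleIso_of_linearEquiv (h : IsConjAction A x y X Y) (H : Subgroup G)
    {N N' : Submodule S (Additive A)} (e : N ≃ₗ[S] N') :
    ModuleIso H (ofSubmodule N) (ofSubmodule N') := by
  refine ⟨(ofSubmoduleEquiv N).symm.trans
    ((AddEquiv.toMultiplicative e.toAddEquiv).trans (ofSubmoduleEquiv N')), ?_⟩
  intro g _ v v' hv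
  obtain ⟨m, rfl⟩ := (ofSubmoduleEquiv N).surjective v
  obtain ⟨m', rfl⟩ := (ofSubmoduleEquiv N).surjective v'
  obtain ⟨s, hs⟩ := h.exists_smul_eq_conjBy g
  rw [coe_ofSubmoduleEquiv, coe_ofSubmoduleEquiv, ← hs] at hv
  have hm : m'.toAdd = s • m.toAdd := Subtype.ext (addVal_injective hv)
  rw [MulEquiv.trans_apply, MulEquiv.trans_apply, MulEquiv.trans_apply, MulEquiv.trans_apply,
    MulEquiv.symm_apply_apply, MulEquiv.symm_apply_apply, coe_ofSubmoduleEquiv,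
    coe_ofSubmoduleEquiv, ← hs]
  change addVal (e m'.toAdd : Additive A) = addVal (s • (e m.toAdd : Additive A))
  rw [hm, map_smul, Submodule.coe_smul]

/-- An element of the ring that kills `W` also kills each subgroup isomorphic to `W` as a module
for a group containing `x` and `y`. -/
lemma smul_eq_zero_of_moduleIso (h : IsConjAction A x y X Y) {H V W : Subgroup G}
    [hV : V.Normal] (hx : x ∈ H) (hy : y ∈ H) (hW : W ≤ A) (hVW : ModuleIso H V W)
    {s : S} (hs : ∀ m : Additive A, addVal m ∈ W → s • m = 0) {m : Additive A}
    (hm : addVal m ∈ V) : s • m = 0 := by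
  obtain ⟨φ, hφ⟩ := hVW
  -- the graph of the isomorphism, a submodule of `A × A`
  let K : AddSubgroup (Additive A × Additive A) :=
    { carrier := {p | ∃ v : V, addVal p.1 = v ∧ addVal p.2 = φ v}
      zero_mem' := ⟨1, rfl, by simp⟩
      add_mem' := by
        rintro p q ⟨v, h1, h2⟩ ⟨w, h3, h4⟩
        exact ⟨v * w, by simp [h1, h3], by simp [h2, h4]⟩
      neg_mem' := by
        rintro p ⟨v, h1, h2⟩
        exact ⟨v⁻¹, by simp [h1], by simp [h2]⟩ }
  have hK (g : G) (hg : g ∈ H) (t : S) (ht : ∀ m : Additive A, addVal (t • m) = conjBy (addVal m) g)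
      (p) (hp : p ∈ K) : t • p ∈ K := by
    obtain ⟨v, h1, h2⟩ := hp
    refine ⟨⟨conjBy v g, hV.conj_mem' _ v.2 g⟩, ?_, ?_⟩
    · rw [Prod.smul_fst, ht, h1]
    · rw [Prod.smul_snd, ht, h2]
      exact (hφ g hg v _ rfl).symm
  obtain ⟨m', hm'⟩ := exists_addVal_eq (hW (φ ⟨_, hm⟩).2)
  obtain ⟨v, h1, h2⟩ := h.eis.smul_mem K (hK x hx X h.smul_x) (hK y hy Y h.smul_y) s
    (m := (m, m')) ⟨⟨_, hm⟩, rfl, hm'⟩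
  rw [Prod.smul_snd, hs m' (hm' ▸ (φ ⟨_, hm⟩).2), addVal_zero] at h2
  have hv : v = 1 := φ.injective (Subtype.ext (by rw [← h2, map_one]; rfl))
  rw [hv] at h1
  exact addVal_injective h1

end IsConjAction

end Dictionary

/-! ### Homocyclic subgroups, exponents, commutators and ranks -/

section Structure

/-- A subgroup generated by `m` and `x m` is homocyclic of rank `2`. -/
lemma EisensteinInvolution.nonempty_closure_pair_equiv {S M : Type*} [CommRing S] [AddCommGroup M]
    [Module S M] {x y : S} (h : EisensteinInvolution x y) {n : ℕ} {m : M}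
    (hm : (2 ^ (n - 1) : S) • m ≠ 0) (hm' : (2 ^ n : S) • m = 0) :
    Nonempty (ZMod (2 ^ n) × ZMod (2 ^ n) ≃+ AddSubgroup.closure {m, x • m}) := by
  have h0 (m' : M) (hm' : (2 ^ n : S) • m' = 0) :
      zmultiplesHom M m' ((2 ^ n : ℕ) : ℤ) = 0 := by
    rw [zmultiplesHom_apply, ← Int.cast_smul_eq_zsmul S]
    exact_mod_cast hm'
  have hxm : (2 ^ n : S) • x • m = 0 := by rw [smul_comm, hm', smul_zero]
  let f : ZMod (2 ^ n) × ZMod (2 ^ n) →+ M :=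
    (ZMod.lift (2 ^ n) ⟨zmultiplesHom M m, h0 m hm'⟩).coprod
      (ZMod.lift (2 ^ n) ⟨zmultiplesHom M (x • m), h0 _ hxm⟩)
  have hf (i j : ℤ) : f (i, j) = i • m + j • x • m := by simp [f]
  have hinj : Function.Injective f := by
    rw [injective_iff_map_eq_zero]
    rintro ⟨a, b⟩ hab
    obtain ⟨i, rfl⟩ := ZMod.intCast_surjective a
    obtain ⟨j, rfl⟩ := ZMod.intCast_surjective b
    rw [hf, ← Int.cast_smul_eq_zsmul S, ← Int.cast_smul_eq_zsmul S, smul_smul, ← add_smul] at hab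
    obtain ⟨hi, hj⟩ := h.two_pow_dvd_of_smul_eq_zero hm hab
    refine Prod.ext ?_ ?_
    · exact (ZMod.intCast_zmod_eq_zero_iff_dvd i _).2 (by exact_mod_cast hi)
    · exact (ZMod.intCast_zmod_eq_zero_iff_dvd j _).2 (by exact_mod_cast hj)
  have hrange : f.range = AddSubgroup.closure {m, x • m} := by
    ext z
    rw [AddSubgroup.mem_closure_pair]
    constructor
    · rintro ⟨⟨a, b⟩, rfl⟩
      obtain ⟨i, rfl⟩ := ZMod.intCast_surjective a
      obtain ⟨j, rfl⟩ := ZMod.intCast_surjective b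
      exact ⟨i, j, (hf i j).symm⟩
    · rintro ⟨i, j, rfl⟩
      exact ⟨(i, j), hf i j⟩
  exact ⟨(AddMonoidHom.ofInjective hinj).trans (AddEquiv.addSubgroupCongr hrange)⟩

lemma Group.two_le_rank_of_mulEquiv_cyclicSq {K : Type*} [Group K] [Group.FG K] {n : ℕ}
    (hn : n ≠ 0) (e : K ≃* CyclicSq (2 ^ n)) : 2 ≤ Group.rank K := by
  by_contra! hlt
  obtain ⟨s, hs, hcl⟩ := Group.rank_spec K
  have hcyc : IsCyclic K := by
    obtain ⟨g, hg⟩ := Finset.card_le_one_iff_subset_singleton.1 (show s.card ≤ 1 by omega)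
    refine ⟨g, fun k ↦ ?_⟩
    rw [← Subgroup.mem_zpowers_iff, Subgroup.zpowers_eq_closure]
    exact Subgroup.closure_mono (by exact_mod_cast hg) (hcl ▸ Subgroup.mem_top k)
  have h1 := (Group.isCyclic_prod_iff.1 (e.isCyclic.1 hcyc)).2.2
  rw [Nat.card_congr Multiplicative.toAdd, Nat.card_zmod, Nat.coprime_self] at h1
  exact absurd h1 (Nat.one_lt_two_pow hn).ne'

lemma nonempty_linearEquiv_span_singleton {S M : Type*} [CommRing S] [AddCommGroup M]
    [Module S M] {b : M} (hb : ∀ s : S, s • b = 0 → s = 0) :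
    Nonempty (S ≃ₗ[S] Submodule.span S {b}) := by
  have hinj : Function.Injective (LinearMap.toSpanSingleton S M b) := by
    rw [← LinearMap.ker_eq_bot, LinearMap.ker_eq_bot']
    exact hb
  exact ⟨(LinearEquiv.ofInjective _ hinj).trans
    (LinearEquiv.ofEq _ _ (LinearMap.range_toSpanSingleton b))⟩

variable {G : Type u} [Group G] {A : Subgroup G} [IsMulCommutative A]
  {S : Type*} [CommRing S] [Module S (Additive A)] {x y : G} {X Y : S}

lemma addVal_natCast_smul (n : ℕ) (m : Additive A) : addVal ((n : S) • m) = addVal m ^ n := by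
  rw [Nat.cast_smul_eq_nsmul, addVal_nsmul]

lemma exponent_ofSubmodule_dvd_iff {N : Submodule S (Additive A)} {n : ℕ} :
    Monoid.exponent (ofSubmodule N) ∣ n ↔ ∀ m ∈ N, (n : S) • m = 0 := by
  rw [ofSubmodule, exponent_ofAddSubgroup_dvd_iff]
  refine forall₂_congr fun m _ ↦ ?_
  rw [← addVal_natCast_smul (S := S), ← addVal_zero (A := A), addVal_injective.eq_iff]

namespace IsConjAction

lemma commBy_addVal (h : IsConjAction A x y X Y) (m : Additive A) :
    commBy (addVal m) y = addVal ((Y - 1) • m) := by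
  rw [commBy, ← h.smul_y, ← addVal_neg, ← addVal_add]
  congr 1
  module

lemma commSubgroup_ofAddSubgroup (h : IsConjAction A x y X Y) (K : AddSubgroup (Additive A)) :
    commSubgroup (ofAddSubgroup K) y =
      ofAddSubgroup (K.map (DistribSMul.toAddMonoidHom (Additive A) (Y - 1))) := by
  rw [commSubgroup]
  apply le_antisymm
  · rw [Subgroup.closure_le]
    rintro _ ⟨_, ⟨m, hm, rfl⟩, rfl⟩
    exact ⟨_, ⟨m, hm, rfl⟩, (h.commBy_addVal m).symm⟩
  · rw [ofAddSubgroup_le_iff]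
    rintro _ ⟨m, hm, rfl⟩
    exact Subgroup.subset_closure
      ⟨_, addVal_mem_ofAddSubgroup.2 hm, (h.commBy_addVal m).symm⟩

lemma closure_pair (h : IsConjAction A x y X Y) (m : Additive A) :
    Subgroup.closure {addVal m, conjBy (addVal m) x} =
      ofAddSubgroup (AddSubgroup.closure {m, X • m}) := by
  rw [ofAddSubgroup_closure, Set.image_pair, h.smul_x]

lemma nonempty_closure_pair_mulEquiv (h : IsConjAction A x y X Y) {n : ℕ} {m : Additive A}
    (hm : (2 ^ (n - 1) : S) • m ≠ 0) (hm' : (2 ^ n : S) • m = 0) :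
    Nonempty (ofAddSubgroup (AddSubgroup.closure {m, X • m}) ≃* CyclicSq (2 ^ n)) := by
  obtain ⟨e⟩ := h.eis.nonempty_closure_pair_equiv hm hm'
  exact ⟨(ofAddSubgroupEquiv _).symm.trans
    ((AddEquiv.toMultiplicative e.symm).trans (MulEquiv.prodMultiplicative _ _))⟩

/-- If `b` generates a free module, then each cyclic module is a quotient of it. -/
lemma rank_normalClosure_le [Finite G] (h : IsConjAction A x y X Y) {b : Additive A}
    (hb : ∀ s : S, s • b = 0 → s = 0) (c : Additive A) :
    Group.rank (Subgroup.normalClosure {addVal c}) ≤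
      Group.rank (Subgroup.normalClosure {addVal b}) := by
  rw [← Subgroup.rank_congr (h.ofSubmodule_span_singleton b),
    ← Subgroup.rank_congr (h.ofSubmodule_span_singleton c)]
  obtain ⟨e⟩ := nonempty_linearEquiv_span_singleton hb
  let f : S →ₗ[S] Submodule.span S {c} :=
    (LinearMap.toSpanSingleton S (Additive A) c).codRestrict _ fun s ↦
      Submodule.mem_span_singleton.2 ⟨s, rfl⟩
  have hf : Function.Surjective f := by
    rintro ⟨m, hm⟩
    obtain ⟨s, rfl⟩ := Submodule.mem_span_singleton.1 hm
    exact ⟨s, rfl⟩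
  let φ := (ofSubmoduleEquiv _).toMonoidHom.comp
    ((AddMonoidHom.toMultiplicative (f.comp e.symm.toLinearMap).toAddMonoidHom).comp
      (ofSubmoduleEquiv _).symm.toMonoidHom)
  have hφ : Function.Surjective φ := by
    simp only [φ, MonoidHom.coe_comp]
    exact (ofSubmoduleEquiv _).surjective.comp
      ((hf.comp e.symm.surjective).comp (ofSubmoduleEquiv _).symm.surjective)
  exact Group.rank_le_of_surjective φ hφ

end IsConjAction

end Structure

/-! ### The decomposition into a free module and a torsion module -/

section Decomposition

variable {G : Type u} [Group G] {A : Subgroup G} [IsMulCommutative A]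
  {S : Type*} [CommRing S] [Module S (Additive A)] {x y : G} {X Y : S}

namespace IsConjAction

lemma finite_ring [Finite G] (h : IsConjAction A x y X Y) : Finite S := by
  have : Finite (Additive A) := inferInstanceAs (Finite A)
  refine Finite.of_injective (fun s : S ↦ fun m : Additive A ↦ s • m) fun s t hst ↦ ?_
  refine sub_eq_zero.1 (h.faithful _ fun m ↦ ?_)
  rw [sub_smul, sub_eq_zero]
  exact congrFun hst m

/-- If `2 ^ (n - 1)` lies in each nonzero ideal, then the module `A` is the direct sum of a free
module `B` and a module `C` killed by `2 ^ (n - 1)`. -/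
theorem exists_decomposition [Finite G] (h : IsConjAction A x y X Y) (H : Subgroup G) {n : ℕ}
    (hσ : ∀ s : S, s ≠ 0 → ∃ t, t * s = 2 ^ (n - 1)) (h0 : (2 : S) ^ (n - 1) ≠ 0)
    (hδ : ∃ u : S, 2 * (Y - 1) = u * 2 ^ (n - 1)) :
    ∃ B C : Subgroup G, B.Normal ∧ C.Normal ∧ B ⊓ C = ⊥ ∧ B ⊔ C = A ∧
      Monoid.exponent (commSubgroup C y) ≤ 2 ∧ commSubgroup (commSubgroup C y) y = ⊥ ∧
      (∀ m : Additive A, addVal m ∈ C → (2 ^ (n - 1) : S) • m = 0) ∧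
      ∃ (k : ℕ) (b : Additive A), 0 < k ∧ addVal b ∈ B ∧ (∀ s : S, s • b = 0 → s = 0) ∧
        IsDirectProductOfCopies H B (Subgroup.normalClosure {addVal b}) k ∧
        Monoid.exponent C < Monoid.exponent B := by
  have := h.finite_ring
  have : Finite (Additive A) := inferInstanceAs (Finite A)
  obtain ⟨k, b, C, hb, hinf, hsup, hC⟩ :=
    exists_free_sup_torsion (M := Additive A) hσ ⊤
  have hb0 (i : Fin k) (s : S) (hs : s • b i = 0) : s = 0 :=
    linearIndependent_iff'.1 hb {i} (fun _ ↦ s) (by simpa using hs) i (by simp)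
  have hk : 0 < k := by
    rcases Nat.eq_zero_or_pos k with rfl | hk
    · refine absurd (h.faithful _ fun m ↦ hC m ?_) h0
      have : m ∈ Submodule.span S (Set.range b) ⊔ C := hsup ▸ Submodule.mem_top
      simpa using this
    · exact hk
  have hδC (m : Additive A) (hm : m ∈ C) : (2 * (Y - 1)) • m = 0 := by
    obtain ⟨u, hu⟩ := hδ
    rw [hu, mul_smul, hC m hm, smul_zero]
  have hbB : addVal (b ⟨0, hk⟩) ∈ ofSubmodule (Submodule.span S (Set.range b)) :=
    addVal_mem_ofSubmodule.2 (Submodule.subset_span ⟨_, rfl⟩)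
  refine ⟨ofSubmodule (Submodule.span S (Set.range b)), ofSubmodule C, h.normal_ofSubmodule _,
    h.normal_ofSubmodule _, ?_, ?_, ?_, ?_, ?_, k, b ⟨0, hk⟩, hk, hbB, hb0 _, ?_, ?_⟩
  · rw [← ofSubmodule_inf, hinf, ofSubmodule_bot]
  · rw [← ofSubmodule_sup, hsup, ofSubmodule_top]
  · refine Nat.le_of_dvd two_pos ?_
    rw [ofSubmodule, h.commSubgroup_ofAddSubgroup, exponent_ofAddSubgroup_dvd_iff]
    rintro _ ⟨m, hm, rfl⟩
    rw [← addVal_natCast_smul (S := S), ← addVal_zero (A := A), ← hδC m hm, mul_smul]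
    rfl
  · rw [ofSubmodule, h.commSubgroup_ofAddSubgroup, h.commSubgroup_ofAddSubgroup, eq_bot_iff,
      ofAddSubgroup_le_iff]
    rintro _ ⟨_, ⟨m, hm, rfl⟩, rfl⟩
    have e : (Y - 1) • (Y - 1) • m = 0 := by
      have e' : (Y ^ 2) • m = m := by rw [h.eis.sq_eq, one_smul]
      linear_combination (norm := module) -hδC m hm + e'
    rw [Subgroup.mem_bot, ← addVal_zero (A := A), ← e]
    rfl
  · exact fun m hm ↦ hC m (addVal_mem_ofSubmodule.1 hm)
  · refine ⟨fun i ↦ ofSubmodule (Submodule.span S {b i}), fun i ↦ h.normal_ofSubmodule _,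
      fun i ↦ ?_, iSupIndep_ofSubmodule hb.iSupIndep_span_singleton, ?_⟩
    · obtain ⟨e⟩ := nonempty_linearEquiv_span_singleton (hb0 i)
      obtain ⟨e'⟩ := nonempty_linearEquiv_span_singleton (hb0 ⟨0, hk⟩)
      rw [← h.ofSubmodule_span_singleton]
      exact h.moduleIso_of_linearEquiv H (e.symm.trans e')
    · rw [← ofSubmodule_iSup, Submodule.span_range_eq_iSup]
  · have h1 : Monoid.exponent (ofSubmodule C) ∣ 2 ^ (n - 1) :=
      exponent_ofSubmodule_dvd_iff.2 (by exact_mod_cast hC)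
    refine (Nat.le_of_dvd (by positivity) h1).trans_lt ?_
    by_contra! hle
    obtain ⟨N, hN⟩ := h.eis.nil
    have h2 : Monoid.exponent (ofSubmodule (Submodule.span S (Set.range b))) ∣ 2 ^ N :=
      exponent_ofSubmodule_dvd_iff.2 fun m _ ↦ by
        rw [Nat.cast_pow, Nat.cast_ofNat, hN, zero_smul]
    obtain ⟨j, -, hj⟩ := (Nat.dvd_prime_pow Nat.prime_two).1 h2
    rw [hj] at hle
    have h3 := exponent_ofSubmodule_dvd_iff.1
      (hj ▸ pow_dvd_pow 2 ((Nat.pow_le_pow_iff_right one_lt_two).1 hle)) _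
      (addVal_mem_ofSubmodule.1 hbB)
    exact h0 (hb0 ⟨0, hk⟩ _ (by exact_mod_cast h3))

end IsConjAction

end Decomposition

/-! ### The structure of the normal closure of an element -/

section NormalClosure

variable {G : Type u} [Group G] {A : Subgroup G} [IsMulCommutative A]
  {S : Type*} [CommRing S] [Module S (Additive A)] {x y : G} {X Y : S}

namespace IsConjAction

section scalar

variable {m : Additive A}

/-- If `y` acts as an integral combination of `1` and `x`, the normal closure of an element `a` of
`A` is generated by `a` and `a ^ x`. -/
lemma normalClosure_eq_closure_pair (h : IsConjAction A x y X Y) (hY : Y + 1 = 4 * X)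
    (m : Additive A) : Subgroup.normalClosure {addVal m} =
      ofAddSubgroup (AddSubgroup.closure {m, X • m}) := by
  apply le_antisymm
  · rw [← h.ofSubmodule_span_singleton, ofSubmodule_le_iff]
    intro m' hm'
    obtain ⟨s, rfl⟩ := Submodule.mem_span_singleton.1 hm'
    obtain ⟨i, j, k, l, rfl⟩ := h.eis.gen s
    rw [addVal_mem_ofAddSubgroup, AddSubgroup.mem_closure_pair]
    refine ⟨i - k - 4 * l, j - l + 4 * k - 4 * l, ?_⟩
    rw [← Int.cast_smul_eq_zsmul S, ← Int.cast_smul_eq_zsmul S, smul_smul, ← add_smul]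
    congr 1
    push_cast
    linear_combination -(k + l * X) * hY - 4 * l * h.eis.sq_add
  · rw [← h.ofSubmodule_span_singleton, ofSubmodule]
    refine ofAddSubgroup_mono ((AddSubgroup.closure_le _).2 ?_)
    rw [Set.insert_subset_iff, Set.singleton_subset_iff]
    exact ⟨Submodule.mem_span_singleton_self m, Submodule.mem_span_singleton.2 ⟨X, rfl⟩⟩

/-- The normal closure of a nontrivial element is homocyclic of rank `2` if `y = -1 + 4 x`. -/
lemma rank_normalClosure_eq_two [Finite G] (h : IsConjAction A x y X Y) (hY : Y + 1 = 4 * X)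
    (hm : m ≠ 0) : Group.rank (Subgroup.normalClosure {addVal m}) = 2 := by
  apply le_antisymm
  · rw [h.normalClosure_eq_closure_pair hY, ← h.closure_pair]
    exact (Subgroup.rank_closure_finite_le_nat_card _).trans
      ((Nat.card_coe_set_eq _).trans_le ((Set.ncard_insert_le _ _).trans (by simp)))
  · have hex : ∃ n, (2 ^ n : S) • m = 0 := h.eis.nil.imp fun N hN ↦ by rw [hN, zero_smul]
    classical
    have h0 : Nat.find hex ≠ 0 := fun h0 ↦ hm (by simpa [h0] using Nat.find_spec hex)
    obtain ⟨e⟩ := h.nonempty_closure_pair_mulEquiv (n := Nat.find hex)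
      (Nat.find_min hex (by omega)) (Nat.find_spec hex)
    rw [Subgroup.rank_congr (h.normalClosure_eq_closure_pair hY m)]
    exact Group.two_le_rank_of_mulEquiv_cyclicSq h0 e

lemma mul_conjBy_eq (h : IsConjAction A x y X Y) (hY : (Y + 1) • m = (4 * X) • m) :
    addVal m * conjBy (addVal m) y = conjBy (addVal m ^ 4) x := by
  rw [← h.smul_y, ← addVal_nsmul, ← h.smul_x, ← addVal_add]
  congr 1
  linear_combination (norm := module) hY

lemma conjBy_eq_inv (h : IsConjAction A x y X Y) (hY : (Y + 1) • m = (4 * X) • m)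
    (hm : (2 ^ 2 : S) • m = 0) : conjBy (addVal m) y = (addVal m)⁻¹ := by
  rw [← h.smul_y, ← addVal_neg]
  congr 1
  linear_combination (norm := module) hY + X • hm

end scalar

section twoPow

variable {n : ℕ} {m : Additive A}

lemma pow_eq_conjBy (h : IsConjAction A x y X Y) (hY : (2 : S) ^ (n - 1) = 2 * X * (Y - 1)) :
    addVal m ^ (2 ^ (n - 1)) = conjBy (commBy (addVal m ^ 2) y) x := by
  rw [← addVal_natCast_smul (S := S), ← addVal_nsmul, h.commBy_addVal, ← h.smul_x]
  congr 1
  push_cast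
  rw [hY]
  module

lemma commSubgroup_closure_pair (h : IsConjAction A x y X Y) (m : Additive A) :
    commSubgroup (Subgroup.closure {addVal m, conjBy (addVal m) x}) y =
      ofAddSubgroup (AddSubgroup.closure {(Y - 1) • m, X • (Y - 1) • m}) := by
  rw [h.closure_pair, h.commSubgroup_ofAddSubgroup, AddMonoidHom.map_closure, Set.image_pair]
  simp only [DistribSMul.toAddMonoidHom_apply, smul_comm X (Y - 1) m]

/-- If `2 ^ (n - 1) = 2 x (y - 1)`, then `(y - 1) m` has order `4` when `m` has order `2 ^ n`. -/
lemma nonempty_commSubgroup_mulEquiv (h : IsConjAction A x y X Y) (hn : 3 ≤ n)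
    (hY : (2 : S) ^ (n - 1) = 2 * X * (Y - 1)) (hm : (2 ^ (n - 1) : S) • m ≠ 0) :
    Nonempty (commSubgroup (Subgroup.closure {addVal m, conjBy (addVal m) x}) y ≃* CyclicSq 4) := by
  have h2 := h.eis.two_pow_eq_zero_of_eq hn hY
  rw [h.commSubgroup_closure_pair]
  refine h.nonempty_closure_pair_mulEquiv (n := 2) (fun h0 ↦ hm ?_) ?_
  · rw [hY]
    linear_combination (norm := module) X • h0
  · have h4 : (2 ^ 2 * (Y - 1) : S) = 0 := by
      have e : (2 : S) ^ n = 2 * (2 * X * (Y - 1)) := by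
        rw [← hY, ← pow_succ', Nat.sub_add_cancel (by omega)]
      linear_combination X ^ 2 * (h2 - e) - 4 * (Y - 1) * h.eis.cube
    rw [smul_smul, h4, zero_smul]

/-- The ring is additively generated by `1`, `x`, `y - 1` and `x (y - 1)`. -/
lemma normalClosure_eq_closure_pair_sup (h : IsConjAction A x y X Y) (m : Additive A) :
    Subgroup.normalClosure {addVal m} = Subgroup.closure {addVal m, conjBy (addVal m) x} ⊔
      commSubgroup (Subgroup.closure {addVal m, conjBy (addVal m) x}) y := by
  rw [h.commSubgroup_closure_pair, h.closure_pair, ← h.ofSubmodule_span_singleton]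
  apply le_antisymm
  · rw [ofSubmodule_le_iff]
    intro m' hm'
    obtain ⟨s, rfl⟩ := Submodule.mem_span_singleton.1 hm'
    obtain ⟨i, j, k, l, rfl⟩ := h.eis.gen s
    have e : ((i : S) + j * X + (k + l * X) * Y) • m = ((i + k : ℤ) • m + (j + l : ℤ) • X • m) +
        (k • (Y - 1) • m + l • X • (Y - 1) • m) := by
      simp only [← Int.cast_smul_eq_zsmul S]
      push_cast
      module
    rw [e, addVal_add]
    exact mul_mem
      (Subgroup.mem_sup_left (addVal_mem_ofAddSubgroup.2
        (AddSubgroup.mem_closure_pair.2 ⟨_, _, rfl⟩)))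
      (Subgroup.mem_sup_right (addVal_mem_ofAddSubgroup.2
        (AddSubgroup.mem_closure_pair.2 ⟨_, _, rfl⟩)))
  · have hmem (s : S) : s • m ∈ Submodule.span S {m} := Submodule.mem_span_singleton.2 ⟨s, rfl⟩
    refine sup_le (ofAddSubgroup_mono ((AddSubgroup.closure_le _).2 ?_))
      (ofAddSubgroup_mono ((AddSubgroup.closure_le _).2 ?_))
    · rw [Set.insert_subset_iff, Set.singleton_subset_iff]
      exact ⟨Submodule.mem_span_singleton_self m, hmem X⟩
    · rw [Set.insert_subset_iff, Set.singleton_subset_iff, smul_smul]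
      exact ⟨hmem _, hmem _⟩

end twoPow

end IsConjAction

end NormalClosure

/-! ### The action of `y` recovered from a decomposition -/

section Converse

lemma pow_eq_one_of_mulEquiv_cyclicSq {K : Type*} [Group K] {n : ℕ} (e : K ≃* CyclicSq n) (k : K) :
    k ^ n = 1 := by
  apply e.injective
  rw [map_pow, map_one]
  refine Prod.ext (Multiplicative.toAdd.injective ?_) (Multiplicative.toAdd.injective ?_) <;>
  simp

variable {G : Type u} [Group G] {A : Subgroup G} [IsMulCommutative A]
  {S : Type*} [CommRing S] [Module S (Additive A)] {x y : G} {X Y : S}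

namespace IsConjAction

lemma symm (h : IsConjAction A x y X Y) (hx : x ^ 3 = 1) : IsConjAction A (x ^ 2) y (X ^ 2) Y where
  eis := h.eis.symm
  smul_x m := by
    rw [pow_two X, mul_smul, h.smul_x, h.smul_x]
    simp only [conjBy, pow_two]
    group
  smul_y := h.smul_y
  faithful := h.faithful
  sup_eq_top := by
    rw [eq_top_iff, ← h.sup_eq_top]
    have h1 : x ∈ Subgroup.zpowers (x ^ 2) := by
      refine Subgroup.mem_zpowers_iff.2 ⟨2, ?_⟩
      rw [zpow_ofNat, ← pow_mul, pow_succ, hx, one_mul]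
    gcongr
    exact Subgroup.zpowers_le.2 h1

section converse

variable {H B C : Subgroup G} {b : Additive A} {k : ℕ} {s : S}

/-- A ring element that kills `b` kills each direct product of copies of the normal closure of
`b`. -/
lemma smul_eq_zero_of_isDirectProductOfCopies (h : IsConjAction A x y X Y) (hx : x ∈ H) (hy : y ∈ H)
    (hBA : B ≤ A) (hB : IsDirectProductOfCopies H B (Subgroup.normalClosure {addVal b}) k)
    (hs : s • b = 0) {m : Additive A} (hm : addVal m ∈ B) : s • m = 0 := by
  obtain ⟨f, hf, hiso, -, rfl⟩ := hB
  let T := LinearMap.ker (LinearMap.lsmul S (Additive A) s)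
  suffices ⨆ i, f i ≤ ofSubmodule T from addVal_mem_ofSubmodule.1 (this hm)
  refine iSup_le fun i g hg ↦ ?_
  obtain ⟨m, rfl⟩ := exists_addVal_eq (hBA ((le_iSup f i) hg))
  have := hf i
  rw [addVal_mem_ofSubmodule]
  rw [← h.ofSubmodule_span_singleton] at hiso
  refine h.smul_eq_zero_of_moduleIso hx hy ?_ (hiso i) (fun m' hm' ↦ ?_) hg
  · exact ofSubmodule_le_iff.2 fun m _ ↦ addVal_mem m
  · obtain ⟨t, rfl⟩ := Submodule.mem_span_singleton.1 (addVal_mem_ofSubmodule.1 hm')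
    rw [smul_comm, hs, smul_zero]

lemma eq_zero_of_smul_eq_zero (h : IsConjAction A x y X Y) (hBC : B ⊔ C = A)
    (hB : ∀ m : Additive A, addVal m ∈ B → s • m = 0)
    (hC : ∀ m : Additive A, addVal m ∈ C → s • m = 0) : s = 0 := by
  let T := LinearMap.ker (LinearMap.lsmul S (Additive A) s)
  have key (D : Subgroup G) (hDA : D ≤ A) (hD : ∀ m : Additive A, addVal m ∈ D → s • m = 0) :
      D ≤ ofSubmodule T := by
    intro g hg
    obtain ⟨m, rfl⟩ := exists_addVal_eq (hDA hg)
    exact addVal_mem_ofSubmodule.2 (hD m hg)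
  refine h.faithful s fun m ↦ ?_
  have hle := sup_le (key B (hBC ▸ le_sup_left) hB) (key C (hBC ▸ le_sup_right) hC)
  rw [hBC] at hle
  exact addVal_mem_ofSubmodule.1 (hle (addVal_mem m))

lemma two_mul_sub_one_smul_eq_zero [Finite G] (h : IsConjAction A x y X Y)
    (he : Monoid.exponent (commSubgroup C y) ≤ 2) {m : Additive A} (hm : addVal m ∈ C) :
    (2 * (Y - 1)) • m = 0 := by
  have h0 := Monoid.exponent_ne_zero_of_finite (G := commSubgroup C y)
  have h2 : Monoid.exponent (commSubgroup C y) ∣ 2 := by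
    generalize Monoid.exponent (commSubgroup C y) = e at *
    interval_cases e <;> simp_all
  have h3 := Monoid.exponent_dvd_iff_forall_pow_eq_one.1 h2
    ⟨commBy (addVal m) y, Subgroup.subset_closure ⟨_, hm, rfl⟩⟩
  replace h3 : commBy (addVal m) y ^ 2 = 1 := congrArg Subtype.val h3
  rw [h.commBy_addVal, ← addVal_nsmul, ← addVal_zero (A := A), addVal_injective.eq_iff] at h3
  rw [mul_smul, ← h3]
  module

/-- The conditions on `b` and on `C` say that `8` and `y + 1 - 4 x` kill both `B` and `C`, where
`4 C = 0` since `-2` acts on `C` as `y - 1`. -/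
lemma eight_eq_zero_and_add_one_eq [Finite G] (h : IsConjAction A x y X Y) (hx : x ∈ H) (hy : y ∈ H)
    (hBC : B ⊔ C = A) (hB : IsDirectProductOfCopies H B (Subgroup.normalClosure {addVal b}) k)
    (he : Monoid.exponent (commSubgroup C y) ≤ 2)
    (h8 : Nonempty (Subgroup.normalClosure {addVal b} ≃* CyclicSq 8))
    (hb : addVal b * conjBy (addVal b) y = conjBy (addVal b ^ 4) x)
    (hC : ∀ c ∈ C, conjBy c y = c⁻¹) : (8 : S) = 0 ∧ Y + 1 = 4 * X := by
  have hBA : B ≤ A := hBC ▸ le_sup_left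
  have hYC (m : Additive A) (hm : addVal m ∈ C) : Y • m = -m := by
    apply addVal_injective
    rw [h.smul_y, hC _ hm, addVal_neg]
  have h4C (m : Additive A) (hm : addVal m ∈ C) : (4 : S) • m = 0 := by
    linear_combination (norm := module) 2 • hYC m hm - h.two_mul_sub_one_smul_eq_zero he hm
  constructor
  · refine h.eq_zero_of_smul_eq_zero hBC (fun m ↦
      h.smul_eq_zero_of_isDirectProductOfCopies hx hy hBA hB ?_) fun m hm ↦ ?_
    · obtain ⟨e⟩ := h8
      have := congrArg Subtype.val (pow_eq_one_of_mulEquiv_cyclicSq e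
        ⟨addVal b, Subgroup.subset_normalClosure rfl⟩)
      apply addVal_injective
      exact (addVal_natCast_smul 8 b).trans this
    · linear_combination (norm := module) 2 • h4C m hm
  · refine sub_eq_zero.1 (h.eq_zero_of_smul_eq_zero hBC (fun m ↦
      h.smul_eq_zero_of_isDirectProductOfCopies hx hy hBA hB ?_) fun m hm ↦ ?_)
    · rw [← h.smul_y, ← addVal_nsmul, ← h.smul_x, ← addVal_add, addVal_injective.eq_iff] at hb
      linear_combination (norm := module) hb
    · linear_combination (norm := module) hYC m hm - X • h4C m hm

/-- The conditions on `b` and on `C` say that `2 ^ (n - 1) - 2 x (y - 1)` kills both `B` and `C`: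
the exponents being powers of `2`, `C` is killed by `2 ^ (n - 1)`. -/
lemma two_pow_eq [Finite G] (h : IsConjAction A x y X Y) (hx : x ∈ H) (hy : y ∈ H)
    (hBC : B ⊔ C = A) (hB : IsDirectProductOfCopies H B (Subgroup.normalClosure {addVal b}) k)
    (he : Monoid.exponent (commSubgroup C y) ≤ 2) (hexp : Monoid.exponent C < Monoid.exponent B)
    {n : ℕ} (hn : 3 ≤ n)
    (hE : Nonempty (Subgroup.closure {addVal b, conjBy (addVal b) x} ≃* CyclicSq (2 ^ n)))
    (hb : addVal b ^ (2 ^ (n - 1)) = conjBy (commBy (addVal b ^ 2) y) x) :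
    (2 : S) ^ (n - 1) = 2 * X * (Y - 1) := by
  have hBA : B ≤ A := hBC ▸ le_sup_left
  have hCA : C ≤ A := hBC ▸ le_sup_right
  have hB2 : Monoid.exponent B ∣ 2 ^ n := by
    obtain ⟨e⟩ := hE
    have h1 := congrArg Subtype.val (pow_eq_one_of_mulEquiv_cyclicSq e
      ⟨addVal b, Subgroup.subset_closure (by simp)⟩)
    have h2 : ((2 ^ n : ℕ) : S) • b = 0 :=
      addVal_injective ((addVal_natCast_smul (2 ^ n) b).trans h1)
    refine Monoid.exponent_dvd_iff_forall_pow_eq_one.2 fun ⟨g, hg⟩ ↦ Subtype.ext ?_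
    obtain ⟨m, rfl⟩ := exists_addVal_eq (hBA hg)
    have h3 := h.smul_eq_zero_of_isDirectProductOfCopies hx hy hBA hB h2 hg
    exact (addVal_natCast_smul (S := S) (2 ^ n) m).symm.trans (by rw [h3, addVal_zero]; rfl)
  have hC2 : Monoid.exponent C ∣ 2 ^ (n - 1) := by
    obtain ⟨N, hN⟩ := h.eis.nil
    have h2 : Monoid.exponent C ∣ 2 ^ N := by
      refine Monoid.exponent_dvd_iff_forall_pow_eq_one.2 fun ⟨g, hg⟩ ↦ Subtype.ext ?_
      obtain ⟨m, rfl⟩ := exists_addVal_eq (hCA hg)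
      refine (addVal_natCast_smul (S := S) (2 ^ N) m).symm.trans ?_
      rw [Nat.cast_pow, Nat.cast_ofNat, hN, zero_smul, addVal_zero]
      rfl
    obtain ⟨j, -, hj⟩ := (Nat.dvd_prime_pow Nat.prime_two).1 h2
    have h3 := hexp.trans_le (Nat.le_of_dvd (by positivity) hB2)
    rw [hj] at h3 ⊢
    have := (Nat.pow_lt_pow_iff_right one_lt_two).1 h3
    exact pow_dvd_pow 2 (by omega)
  refine sub_eq_zero.1 (h.eq_zero_of_smul_eq_zero hBC (fun m ↦
    h.smul_eq_zero_of_isDirectProductOfCopies hx hy hBA hB ?_) fun m hm ↦ ?_)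
  · rw [← addVal_natCast_smul (S := S), ← addVal_nsmul, h.commBy_addVal, ← h.smul_x,
      addVal_injective.eq_iff] at hb
    push_cast at hb
    linear_combination (norm := module) hb
  · have h1 := congrArg Subtype.val (Monoid.exponent_dvd_iff_forall_pow_eq_one.1 hC2 ⟨_, hm⟩)
    have h2 : ((2 ^ (n - 1) : ℕ) : S) • m = 0 :=
      addVal_injective ((addVal_natCast_smul _ m).trans h1)
    push_cast at h2
    linear_combination (norm := module) h2 - X • h.two_mul_sub_one_smul_eq_zero he hm

end converse

end IsConjAction

end Converse

/-! ### The characterization -/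

section Complement

variable {G : Type u} [Group G] {A : Subgroup G} [IsMulCommutative A] {x y : G}

/-- A complement of order `6` acts fixed-point-freely through its element of order `3`, and hence
makes `A` a module over a ring of the required kind. -/
lemma exists_isConjAction_of_isComplement [Finite G] [A.Normal] (hA : IsPGroup 2 A)
    {H : Subgroup G} (hH : A.IsComplement' H) (hHcomm : ∀ a ∈ H, ∀ b ∈ H, a * b = b * a)
    (hcard : Nat.card H = 6) (hxH : x ∈ H) (hx : orderOf x = 3) (hyH : y ∈ H) (hy : orderOf y = 2)
    (hfix : A ⊓ Subgroup.centralizer (Subgroup.zpowers x : Set G) = ⊥) :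
    ∃ (S : Type u) (_ : CommRing S) (_ : Module S (Additive A)) (X Y : S),
      IsConjAction A x y X Y := by
  have hx3 : x ^ 3 = 1 := hx ▸ pow_orderOf_eq_one x
  have hgen : Subgroup.zpowers x ⊔ Subgroup.zpowers y = H := by
    have hle : Subgroup.zpowers x ⊔ Subgroup.zpowers y ≤ H :=
      sup_le (Subgroup.zpowers_le.2 hxH) (Subgroup.zpowers_le.2 hyH)
    refine Subgroup.eq_of_le_of_card_ge hle ?_
    have h3 := Subgroup.card_dvd_of_le (le_sup_left : Subgroup.zpowers x ≤
      Subgroup.zpowers x ⊔ Subgroup.zpowers y)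
    have h2 := Subgroup.card_dvd_of_le (le_sup_right : Subgroup.zpowers y ≤
      Subgroup.zpowers x ⊔ Subgroup.zpowers y)
    rw [Nat.card_zpowers, hx] at h3
    rw [Nat.card_zpowers, hy] at h2
    have h6 := Nat.Coprime.mul_dvd_of_dvd_of_dvd (by decide : Nat.Coprime 3 2) h3 h2
    rw [hcard]
    exact Nat.le_of_dvd Nat.card_pos h6
  refine exists_isConjAction hA (hHcomm x hxH y hyH) (fun a ha ↦ ?_) (hy ▸ pow_orderOf_eq_one y) ?_
  · -- the product over the orbit of `a` under `x` is fixed by `x`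
    have hmem (g : G) : conjBy a g ∈ A := Subgroup.Normal.conj_mem' ‹_› a ha g
    have hcomm {b c : G} (hb : b ∈ A) (hc : c ∈ A) : b * c = c * b :=
      congrArg Subtype.val (mul_comm (⟨b, hb⟩ : A) ⟨c, hc⟩)
    have ht : a * conjBy a x * conjBy a (x ^ 2) ∈ A := mul_mem (mul_mem ha (hmem x)) (hmem _)
    have hcx : conjBy (a * conjBy a x * conjBy a (x ^ 2)) x =
        a * conjBy a x * conjBy a (x ^ 2) := by
      calc _ = conjBy a x * conjBy a (x ^ 2) * conjBy a (x ^ 3) := by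
            simp only [conjBy, pow_succ, pow_zero, one_mul]
            group
        _ = conjBy a x * conjBy a (x ^ 2) * a := by rw [hx3]; simp [conjBy]
        _ = _ := by rw [hcomm (mul_mem (hmem x) (hmem _)) ha, mul_assoc]
    rw [← Subgroup.mem_bot, ← hfix]
    refine ⟨ht, Subgroup.mem_centralizer_iff.2 ?_⟩
    rintro _ ⟨k, rfl⟩
    refine Commute.zpow_left (Commute.symm ?_) k
    rw [conjBy, mul_assoc, inv_mul_eq_iff_eq_mul] at hcx
    exact hcx
  · rw [sup_assoc, hgen, hH.sup_eq_top]

lemma zpowers_sq_eq (hx : x ^ 3 = 1) : Subgroup.zpowers (x ^ 2) = Subgroup.zpowers x := by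
  refine le_antisymm (Subgroup.zpowers_le.2 (pow_mem (Subgroup.mem_zpowers x) 2))
    (Subgroup.zpowers_le.2 (Subgroup.mem_zpowers_iff.2 ⟨2, ?_⟩))
  rw [zpow_ofNat, ← pow_mul, pow_succ, hx, one_mul]

end Complement

theorem mainTheorem4 {G : Type*} [Group G] [Finite G]
    (A H P Q : Subgroup G) (y : G)
    -- the setting
    (hA_normal : A.Normal) (hA_comm : ∀ a ∈ A, ∀ b ∈ A, a * b = b * a)
    (hA_two : IsPGroup 2 A) (hA_index : A.index = 6)
    (hH : A.IsComplement' H)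
    (hP : ∃ S : Sylow 3 H, P = (S : Subgroup H).map H.subtype)
    (hyH : y ∈ H) (hy : orderOf y = 2)
    (hQ : Q = A ⊔ Subgroup.zpowers y)
    (hQ_nonabelian : ¬ ∀ a ∈ Q, ∀ b ∈ Q, a * b = b * a)
    (hAP : A ⊓ Subgroup.centralizer (P : Set G) = ⊥)
    -- the additional assumptions
    (hH_cyclic : Nonempty (H ≃* Multiplicative (ZMod 6)))
    (hQ_class : 2 < Group.nilpotencyClass Q) :
    (A : Set G) ⊆ nonvanishingSet G ↔
      ∃ B C : Subgroup G, B.Normal ∧ C.Normal ∧ B ⊓ C = ⊥ ∧ B ⊔ C = A ∧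
        Monoid.exponent (commSubgroup C y) ≤ 2 ∧
        commSubgroup (commSubgroup C y) y = ⊥ ∧
        ∃ (k : ℕ) (b₀ : G), 0 < k ∧ b₀ ∈ B ∧
          IsDirectProductOfCopies H B (Subgroup.normalClosure {b₀}) k ∧
          Monoid.exponent C < Monoid.exponent B ∧
          (∀ c ∈ C, Group.rank (Subgroup.normalClosure {c})
            ≤ Group.rank (Subgroup.normalClosure {b₀})) ∧
          ((∃ x : G, Subgroup.zpowers x = P ∧
              Subgroup.normalClosure {b₀} = Subgroup.closure {b₀, conjBy b₀ x} ∧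
              Nonempty (Subgroup.normalClosure {b₀} ≃* CyclicSq 8) ∧
              b₀ * conjBy b₀ y = conjBy (b₀ ^ 4) x ∧
              (∀ c ∈ C, c ≠ 1 → Group.rank (Subgroup.normalClosure {c}) = 2) ∧
              (∀ c ∈ C, conjBy c y = c⁻¹)) ∨
           (∃ (x : G) (E D : Subgroup G) (n : ℕ), Subgroup.zpowers x = P ∧
              Subgroup.normalClosure {b₀} = E ⊔ D ∧
              E = Subgroup.closure {b₀, conjBy b₀ x} ∧ 3 ≤ n ∧
              Nonempty (E ≃* CyclicSq (2 ^ n)) ∧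
              D = commSubgroup E y ∧
              Nonempty (D ≃* CyclicSq 4) ∧
              b₀ ^ (2 ^ (n - 1)) = conjBy (commBy (b₀ ^ 2) y) x)) := by

  have : IsMulCommutative A := ⟨⟨fun a b ↦ Subtype.ext (hA_comm a a.2 b b.2)⟩⟩
  obtain ⟨eH⟩ := hH_cyclic
  have hHcard : Nat.card H = 6 := by
    rw [Nat.card_congr eH.toEquiv, Nat.card_congr Multiplicative.toAdd, Nat.card_zmod]
  have hHcomm (a : G) (ha : a ∈ H) (b : G) (hb : b ∈ H) : a * b = b * a := by
    have : (⟨a, ha⟩ * ⟨b, hb⟩ : H) = ⟨b, hb⟩ * ⟨a, ha⟩ :=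
      eH.injective (by rw [map_mul, map_mul, mul_comm])
    exact congrArg Subtype.val this
  have hPH : P ≤ H := by
    obtain ⟨T, rfl⟩ := hP
    exact Subgroup.map_subtype_le _
  have hPcard : Nat.card P = 3 := by
    obtain ⟨T, rfl⟩ := hP
    have : Fact (Nat.Prime 3) := ⟨Nat.prime_three⟩
    rw [Subgroup.card_map_of_injective H.subtype_injective, T.card_eq_multiplicity, hHcard,
      show (6 : ℕ) = 3 * 2 by rfl, Nat.factorization_mul (by decide) (by decide)]
    simp [Nat.Prime.factorization Nat.prime_three, Nat.Prime.factorization Nat.prime_two]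
  have hy2 : y ^ 2 = 1 := hy ▸ pow_orderOf_eq_one y
  have horder {x : G} (hxP : Subgroup.zpowers x = P) : orderOf x = 3 := by
    rw [← Nat.card_zpowers, hxP, hPcard]
  have hxH {x : G} (hxP : Subgroup.zpowers x = P) : x ∈ H :=
    hPH (hxP ▸ Subgroup.mem_zpowers x)
  have hact {x : G} (hxP : Subgroup.zpowers x = P) :=
    exists_isConjAction_of_isComplement hA_two hH hHcomm hHcard (hxH hxP) (horder hxP) hyH hy
      (hxP ▸ hAP)
  constructor
  · intro hA
    obtain ⟨x, hxP⟩ : ∃ x : G, Subgroup.zpowers x = P := by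
      have : Fact (Nat.Prime 3) := ⟨Nat.prime_three⟩
      exact (Subgroup.isCyclic_iff_exists_zpowers_eq_top P).1 (isCyclic_of_prime_card hPcard)
    obtain ⟨S, _, _, X, Y, h⟩ := hact hxP
    have hx3 : x ^ 3 = 1 := horder hxP ▸ pow_orderOf_eq_one x
    have : Finite (Additive A) := inferInstanceAs (Finite A)
    have hrel (m : Additive A) : OddRelation X Y m := by
      by_contra hm
      obtain ⟨ψ, hψ⟩ := h.eis.exists_orbitSum_eq_zero hm
      exact h.subset_nonvanishingSet_iff.1 hA ψ m hψ
    obtain ⟨m, hm⟩ : ∃ m : Additive A, (2 * (Y - 1)) • m ≠ 0 := by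
      by_contra! h0
      exact absurd (h.nilpotencyClass_le_two hy2 h0) (by rw [← hQ]; omega)
    have hne : 2 * (Y - 1) ≠ 0 := fun h0 ↦ hm (by rw [h0, zero_smul])
    -- passing from the generator `x` to `x ^ 2` exchanges the two values of `ε`
    obtain ⟨ε, hε, hcase⟩ := h.eis.classification hrel hm
    rcases hcase with hcase | ⟨n, hn, hcase⟩
    · obtain ⟨x', X', hx'P, h', hY⟩ : ∃ (x' : G) (X' : S), Subgroup.zpowers x' = P ∧
          IsConjAction A x' y X' Y ∧ Y + 1 = 4 * X' := by
        have hY : Y + 1 = 4 * ε := sub_eq_zero.1 (h.faithful _ fun m ↦ by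
          rw [sub_smul, (hcase m).2, sub_self])
        rcases hε with rfl | rfl
        · exact ⟨x, ε, hxP, h, hY⟩
        · exact ⟨x ^ 2, X ^ 2, (zpowers_sq_eq hx3).trans hxP, h.symm hx3, hY⟩
      have h8 : (8 : S) = 0 := h.faithful _ fun m ↦ (hcase m).1
      have h4 : (2 : S) ^ (3 - 1) ≠ 0 := fun h4 ↦ hne (by
        linear_combination 2 * hY + (2 * X' - 1) * h4)
      obtain ⟨B, C, hB, hC, hinf, hsup, he, hcc, hC4, k, b, hk, hbB, hb, hcop, hexp⟩ :=
        h'.exists_decomposition H (fun s hs ↦ h'.eis.exists_mul_eq_four h8 hY hs) h4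
          ⟨-1, by linear_combination 2 * hY + X' * h8⟩
      have hCA : C ≤ A := hsup ▸ le_sup_right
      have hYm (m : Additive A) : (Y + 1) • m = (4 * X') • m := by rw [hY]
      refine ⟨B, C, hB, hC, hinf, hsup, he, hcc, k, addVal b, hk, hbB, hcop, hexp, ?_,
        .inl ⟨x', hx'P, ?_, ?_, h'.mul_conjBy_eq (hYm b), ?_, ?_⟩⟩
      · intro c hc
        obtain ⟨m, rfl⟩ := exists_addVal_eq (hCA hc)
        exact h'.rank_normalClosure_le hb m
      · rw [h'.normalClosure_eq_closure_pair hY, h'.closure_pair]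
      · rw [h'.normalClosure_eq_closure_pair hY]
        exact h'.nonempty_closure_pair_mulEquiv (n := 3) (fun h0 ↦ h4 (hb _ h0))
          (by rw [show (2 : S) ^ 3 = 8 by norm_num, h8, zero_smul])
      · intro c hc hc1
        obtain ⟨m, rfl⟩ := exists_addVal_eq (hCA hc)
        exact h'.rank_normalClosure_eq_two hY fun h0 ↦ hc1 (by rw [h0, addVal_zero])
      · intro c hc
        obtain ⟨m, rfl⟩ := exists_addVal_eq (hCA hc)
        exact h'.conjBy_eq_inv (hYm m) (hC4 m hc)
    · obtain ⟨x', X', hx'P, h', hY⟩ : ∃ (x' : G) (X' : S), Subgroup.zpowers x' = P ∧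
          IsConjAction A x' y X' Y ∧ (2 : S) ^ (n - 1) = 2 * X' * (Y - 1) := by
        have hY : 2 * (Y - 1) = 2 ^ (n - 1) * ε := sub_eq_zero.1 (h.faithful _ fun m ↦ by
          rw [sub_smul, hcase m, sub_self])
        -- the generator of `P` acts here as the inverse of `ε`
        rcases hε with rfl | rfl
        · exact ⟨x ^ 2, ε ^ 2, (zpowers_sq_eq hx3).trans hxP, h.symm hx3, by
            linear_combination -ε ^ 2 * hY - 2 ^ (n - 1) * h.eis.cube⟩
        · exact ⟨x, X, hxP, h, by
            linear_combination -X * hY - 2 ^ (n - 1) * h.eis.cube⟩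
      have hδ : 2 * (Y - 1) = X' ^ 2 * 2 ^ (n - 1) := by
        linear_combination -X' ^ 2 * hY - 2 * (Y - 1) * h'.eis.cube
      have h0 : (2 : S) ^ (n - 1) ≠ 0 := fun h0 ↦ hne (by rw [hδ, h0, mul_zero])
      obtain ⟨B, C, hB, hC, hinf, hsup, he, hcc, -, k, b, hk, hbB, hb, hcop, hexp⟩ :=
        h'.exists_decomposition H (fun s hs ↦ h'.eis.exists_mul_eq_two_pow hn hY h0 hs) h0 ⟨_, hδ⟩
      have hb0 : (2 ^ (n - 1) : S) • b ≠ 0 := fun hb0 ↦ h0 (hb _ hb0)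
      refine ⟨B, C, hB, hC, hinf, hsup, he, hcc, k, addVal b, hk, hbB, hcop, hexp, ?_,
        .inr ⟨x', _, _, n, hx'P, h'.normalClosure_eq_closure_pair_sup b, rfl, hn, ?_, rfl,
          h'.nonempty_commSubgroup_mulEquiv hn hY hb0, h'.pow_eq_conjBy hY⟩⟩
      · intro c hc
        obtain ⟨m, rfl⟩ := exists_addVal_eq ((hsup ▸ le_sup_right : C ≤ A) hc)
        exact h'.rank_normalClosure_le hb m
      · rw [h'.closure_pair]
        exact h'.nonempty_closure_pair_mulEquiv hb0
          (by rw [h'.eis.two_pow_eq_zero_of_eq hn hY, zero_smul])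
  · rintro ⟨B, C, -, -, -, hBC, he, -, k, b₀, -, hbB, hcop, hexp, -, hcase⟩
    obtain ⟨b, rfl⟩ := exists_addVal_eq ((hBC ▸ le_sup_left : B ≤ A) hbB)
    rcases hcase with ⟨x, hxP, -, h8, hby, -, hCy⟩ |
      ⟨x, _, _, n, hxP, -, rfl, hn, hE, -, -, hb⟩
    · obtain ⟨S, _, _, X, Y, h⟩ := hact hxP
      obtain ⟨h0, hY⟩ := h.eight_eq_zero_and_add_one_eq (hxH hxP) hyH hBC hcop he h8 hby hCy
      exact h.subset_nonvanishingSet_iff.2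
        (h.eis.orbitSum_ne_zero fun m ↦ h.eis.oddRelation_of_add_one_eq h0 hY m)
    · obtain ⟨S, _, _, X, Y, h⟩ := hact hxP
      have hY := h.two_pow_eq (hxH hxP) hyH hBC hcop he hexp hn hE hb
      exact h.subset_nonvanishingSet_iff.2
        (h.eis.orbitSum_ne_zero fun m ↦ h.eis.oddRelation_of_two_pow_eq hn hY m)
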